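/- Let $N\ge 1$, and let $H_0(S_N)$ be the $0$-Hecke monoid, generated by $\pi_i$, $i\in I=\{1,\dots,N-1\}$, with relations $\pi_i^2=\pi_i$, $\pi_i\pi_j=\pi_j\pi_i$ for $|i-j|>1$, and $\pi_i\pi_{i+1}\pi_i=\pi_{i+1}\pi_i\pi_{i+1}$. Let $\mathbb{C}H_0(S_N)$ be its monoid algebra, and let $\Psi$ be the algebra automorphism of $\mathbb{C}H_0(S_N)$ with $\Psi(\pi_i)=1-\pi_i$ for all $i\in I$. For $J\subseteq I$ let $w_J^+$ be the longest element of the submonoid generated by $\{\pi_j : j\in J\}$, where the length of an element is the minimal length of a word in the generators representing it, and put $w_J^-=\Psi(w_J^+)$. A signed diagram is a map $D:I\to\{+,-\}$. For $0\le k\le N-1$ let $D_k$ be the restriction of $D$ to $\{1,\dots,k\}$. Let $P_1,\dots,P_m$ be the maximal intervals of $\{1,\dots,k\}$ on which the sign is constant, in increasing order, and let $\epsilon_j$ be the sign on $P_j$. Put $$L_{D_k}=w_{P_1}^{\epsilon_1}w_{P_2}^{\epsilon_2}\cdots w_{P_m}^{\epsilon_m},\qquad R_{D_k}=w_{P_m}^{\epsilon_m}\cdots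 w_{P_2}^{\epsilon_2}w_{P_1}^{\epsilon_1},\qquad C_{D_k}=L_{D_k}R_{D_k}\in\mathbb{C}H_0(S_N),$$ and $C_D=C_{D_{N-1}}$. Empty products are $1$. Then for every signed diagram $D$ the element $C_D$ is demipotent, that is, $C_D^k=C_D^{k+1}$ for some $k$, and the element $$I_D:=C_{D_1}C_{D_2}\cdots C_{D_{N-1}}$$ is an idempotent satisfying $I_D=C_D^N$; moreover, $I_D=C_D^k$ for every $k$ with $C_D^k=C_D^{k+1}$. Each $I_D$ is primitive, i.e. it is nonzero and is not a sum of two nonzero orthogonal idempotents of $\mathbb{C}H_0(S_N)$. The $I_D$ are $2^{N-1}$ distinct elements, $I_DI_E=0$ for $D\ne E$, and $\sum_D I_D=1$. -/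

import Mathlib

namespace ZeroHecke

/-- The defining relations of the `0`-Hecke monoid `H_0(S_N)`. The node `i ∈ {1, …, N - 1}` of the
Dynkin diagram is represented by the element of `Fin (N - 1)` with value `i - 1`. -/
inductive Rel (N : ℕ) : FreeMonoid (Fin (N - 1)) → FreeMonoid (Fin (N - 1)) → Prop
  | idem (i : Fin (N - 1)) :
      Rel N (FreeMonoid.of i * FreeMonoid.of i) (FreeMonoid.of i)
  | comm (i j : Fin (N - 1)) (h : (i : ℕ) + 1 < (j : ℕ)) :
      Rel N (FreeMonoid.of i * FreeMonoid.of j) (FreeMonoid.of j * FreeMonoid.of i)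
  | braid (i j : Fin (N - 1)) (h : (i : ℕ) + 1 = (j : ℕ)) :
      Rel N (FreeMonoid.of i * FreeMonoid.of j * FreeMonoid.of i)
        (FreeMonoid.of j * FreeMonoid.of i * FreeMonoid.of j)

/-- The `0`-Hecke monoid `H_0(S_N)`. -/
abbrev HeckeMonoid (N : ℕ) : Type := PresentedMonoid (Rel N)

/-- The generator `π_i` of the `0`-Hecke monoid. -/
def gen {N : ℕ} (i : Fin (N - 1)) : HeckeMonoid N := PresentedMonoid.of (Rel N) i

/-- The `0`-Hecke algebra `ℂH_0(S_N)`: the monoid algebra of the `0`-Hecke monoid. -/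
abbrev HeckeAlgebra (N : ℕ) : Type := MonoidAlgebra ℂ (HeckeMonoid N)

/-- The generator `π_i` of the `0`-Hecke algebra. -/
noncomputable def algGen {N : ℕ} (i : Fin (N - 1)) : HeckeAlgebra N :=
  MonoidAlgebra.of ℂ (HeckeMonoid N) (gen i)

theorem gen_idem {N : ℕ} (i : Fin (N - 1)) : gen i * gen i = gen i :=
  PresentedMonoid.mk_eq_mk_of_rel (Rel.idem i)

theorem gen_comm {N : ℕ} (i j : Fin (N - 1)) (h : (i : ℕ) + 1 < (j : ℕ)) :
    gen i * gen j = gen j * gen i :=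
  PresentedMonoid.mk_eq_mk_of_rel (Rel.comm i j h)

theorem gen_braid {N : ℕ} (i j : Fin (N - 1)) (h : (i : ℕ) + 1 = (j : ℕ)) :
    gen i * gen j * gen i = gen j * gen i * gen j :=
  PresentedMonoid.mk_eq_mk_of_rel (Rel.braid i j h)

theorem one_sub_braid {A : Type*} [Ring A] {a b : A} (ha : a * a = a) (hb : b * b = b)
    (h : a * b * a = b * a * b) :
    (1 - a) * (1 - b) * (1 - a) = (1 - b) * (1 - a) * (1 - b) := by
  have h1 : (1 - a) * (1 - b) * (1 - a) =
      1 - a - b + a * b + b * a - a * b * a + (a * a - a) := by noncomm_ring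
  have h2 : (1 - b) * (1 - a) * (1 - b) =
      1 - a - b + a * b + b * a - b * a * b + (b * b - b) := by noncomm_ring
  rw [h1, h2, ha, hb, h, sub_self, sub_self]

/-- The elements `1 - π_i` satisfy the relations of the `0`-Hecke monoid. -/
theorem lift_one_sub_rel {N : ℕ} (a b : FreeMonoid (Fin (N - 1))) (hab : Rel N a b) :
    FreeMonoid.lift (fun i => (1 : HeckeAlgebra N) - algGen i) a =
      FreeMonoid.lift (fun i => (1 : HeckeAlgebra N) - algGen i) b := by
  have hid (i : Fin (N - 1)) : algGen i * algGen i = algGen i := by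
    simp only [algGen, ← map_mul, gen_idem]
  cases hab with
  | idem i =>
    simp only [map_mul, FreeMonoid.lift_eval_of]
    simp only [mul_sub, sub_mul, mul_one, one_mul, hid, sub_self, sub_zero]
  | comm i j h =>
    have hc : algGen i * algGen j = algGen j * algGen i := by
      simp only [algGen, ← map_mul, gen_comm i j h]
    simp only [map_mul, FreeMonoid.lift_eval_of]
    simp only [mul_sub, sub_mul, mul_one, one_mul, hc]
    abel
  | braid i j h =>
    have hb : algGen i * algGen j * algGen i = algGen j * algGen i * algGen j := by
      simp only [algGen, ← map_mul, gen_braid i j h]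
    simp only [map_mul, FreeMonoid.lift_eval_of]
    exact one_sub_braid (hid i) (hid j) hb

/-- The algebra endomorphism `Ψ` of `ℂH_0(S_N)` with `Ψ(π_i) = 1 - π_i`. -/
noncomputable def Psi (N : ℕ) : HeckeAlgebra N →ₐ[ℂ] HeckeAlgebra N :=
  MonoidAlgebra.lift ℂ (HeckeAlgebra N) (HeckeMonoid N)
    (PresentedMonoid.lift (fun i => (1 : HeckeAlgebra N) - algGen i) lift_one_sub_rel)

theorem Psi_algGen {N : ℕ} (i : Fin (N - 1)) : Psi N (algGen i) = 1 - algGen i := by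
  simp [Psi, algGen, gen]

/-- The length of an element of `H_0(S_N)`: the smallest length of a word in the generators that
represents it. -/
noncomputable def length {N : ℕ} (x : HeckeMonoid N) : ℕ :=
  sInf {k | ∃ w : List (Fin (N - 1)), w.length = k ∧ (w.map gen).prod = x}

/-- The parabolic submonoid generated by the `π_i` with `i ∈ J`. -/
def parabolic {N : ℕ} (J : Set (Fin (N - 1))) : Submonoid (HeckeMonoid N) :=
  Submonoid.closure (gen '' J)

/-- `x` is an element of maximal length in the parabolic submonoid with index set `J`. -/
def IsLongest {N : ℕ} (J : Set (Fin (N - 1))) (x : HeckeMonoid N) : Prop :=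
  x ∈ parabolic J ∧ ∀ y ∈ parabolic J, length y ≤ length x

/-- The longest element `w_J^+` of the parabolic submonoid with index set `J` (it exists and is
unique, because `H_0(S_N)` is the `0`-Hecke monoid of a finite Coxeter group). -/
noncomputable def longest {N : ℕ} (J : Set (Fin (N - 1))) : HeckeMonoid N :=
  Classical.epsilon (IsLongest J)

/-- The element `w_J^+` of the `0`-Hecke algebra. -/
noncomputable def wPlus {N : ℕ} (J : Set (Fin (N - 1))) : HeckeAlgebra N :=
  MonoidAlgebra.of ℂ (HeckeMonoid N) (longest J)

/-- The element `w_J^- = Ψ(w_J^+)`: the longest element in the generators `1 - π_i`, `i ∈ J`. -/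
noncomputable def wMinus {N : ℕ} (J : Set (Fin (N - 1))) : HeckeAlgebra N :=
  Psi N (wPlus J)

/-- A signed diagram for `S_N`: a labelling of the nodes of the Dynkin diagram by signs, where
`true` is `+` and `false` is `-`. -/
abbrev SignedDiagram (N : ℕ) : Type := Fin (N - 1) → Bool

/-- The blocks `P_1, …, P_m` of the diagram `D_k` formed by the first `k` nodes of `D`, in
increasing order: the maximal runs of adjacent nodes with the same sign. -/
def blocks {N : ℕ} (D : SignedDiagram N) (k : ℕ) : List (List (Fin (N - 1))) :=
  ((List.finRange (N - 1)).take k).splitBy (fun i j => D i == D j)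

/-- The factor `w_B^±` attached to a block `B`, with the common sign of the nodes of `B`. -/
noncomputable def blockElement {N : ℕ} (D : SignedDiagram N) (B : List (Fin (N - 1))) :
    HeckeAlgebra N :=
  if ∀ i ∈ B, D i = true then wPlus {i | i ∈ B} else wMinus {i | i ∈ B}

/-- `L_{D_k}`: the product of the block elements of `D_k` from left to right. -/
noncomputable def leftFactor {N : ℕ} (D : SignedDiagram N) (k : ℕ) : HeckeAlgebra N :=
  ((blocks D k).map (blockElement D)).prod

/-- `R_{D_k}`: the product of the block elements of `D_k` from right to left. -/
noncomputable def rightFactor {N : ℕ} (D : SignedDiagram N) (k : ℕ) : HeckeAlgebra N :=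
  ((blocks D k).reverse.map (blockElement D)).prod

/-- `C_{D_k} = L_{D_k} R_{D_k}`, as an element of `ℂH_0(S_N)`, where `D_k` consists of the first
`k` nodes of `D`. -/
noncomputable def prefixDemipotent {N : ℕ} (D : SignedDiagram N) (k : ℕ) : HeckeAlgebra N :=
  leftFactor D k * rightFactor D k

/-- The diagram demipotent `C_D = L_D R_D`, where `D` has `N - 1` nodes. -/
noncomputable def diagramDemipotent {N : ℕ} (D : SignedDiagram N) : HeckeAlgebra N :=
  prefixDemipotent D (N - 1)

/-- `I_D = C_{D_1} C_{D_2} ⋯ C_{D_{N-1}}`, where `D_{N-1} = D`. -/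
noncomputable def diagramIdempotent {N : ℕ} (D : SignedDiagram N) : HeckeAlgebra N :=
  ((List.range (N - 1)).map (fun k => prefixDemipotent D (k + 1))).prod

/-- An element `x` is demipotent if `x ^ k = x ^ (k + 1)` for some `k`. -/
def IsDemipotent {M : Type*} [Monoid M] (x : M) : Prop :=
  ∃ k : ℕ, x ^ k = x ^ (k + 1)

/-- A primitive idempotent: a nonzero idempotent that is not the sum of two nonzero orthogonal
idempotents. -/
def IsPrimitiveIdempotent {A : Type*} [Ring A] (e : A) : Prop :=
  IsIdempotentElem e ∧ e ≠ 0 ∧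
    ∀ f g : A, IsIdempotentElem f → IsIdempotentElem g → f * g = 0 → g * f = 0 →
      e = f + g → f = 0 ∨ g = 0

end ZeroHecke

/-!
# Orthogonal idempotents of the `0`-Hecke algebra from signed diagrams

Write `x_k^+ = π_k` and `x_k^- = 1 - π_k`; both families satisfy the `0`-Hecke relations. With the
nodes numbered from `0`, longest elements of intervals satisfy `w_{P ∪ {k}} = w_P x_k w_P`, so that
`C_{D_{k+1}} = L_{D_k} x_k^ε R_{D_k}`, where `ε` is the sign of the node `k`
(`prefixDemipotent_succ`). Hence the two diagrams that extend `D_k` by one node have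
demipotents with sum `C_{D_k}`. The heart of the proof is *sibling rivalry*: these two demipotents
annihilate each other (`sibling_rivalry`).

It is proved for an arbitrary list of signed blocks, which are added from right to left around
`H = x_k^ε` and `H' = x_k^{-ε}`. The induction carries two facts (`sandwich_mul_sandwich_aux`):
`H H' = 0`, and `x H x H' x = 0` when `x` is `π_c` or `1 - π_c` for the node `c` that precedes the
blocks. Adding a block `P` with last generator `y` replaces `H` by `w_P H w_P`, and likewise `H'`.
Since `w_P` without its last node commutes with `H` and `H'`, the first fact reduces to
`y H y H' y = 0`. For the second one, the product of the longest elements of two overlapping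
intervals is one letter away from the longest element of their union, and this letter can be
taken at either end; it moves the generator of the node `c` across to `y` or `1 - y`.

Sibling rivalry gives `C_{D_k} C_{D_{k+1}} = C_{D_{k+1}}^2 = C_{D_{k+1}} C_{D_k}`, hence
`C_{D_1} ⋯ C_{D_k} = C_{D_k}^m` for all `m ≥ k`. This makes the `I_D` idempotents; they are orthogonal
because two diagrams have siblings as prefixes at the first node where they differ, and they add up
to `1` because siblings add up to their parent.

Primitivity comes from the `2^{N-1}` characters `χ_E` of the algebra: `χ_E(I_D)` is `1` if `E = D`
and `0` otherwise, and an idempotent on which all characters vanish is zero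
(`eq_zero_of_heckeChar_eq_zero`). The latter holds because left multiplication is triangular
in the basis `H_0(S_N)`, ordered by the number of missing inversions, with characters on the
diagonal. This rests on the faithfulness of the action of `H_0(S_N)` by bubble sort
(`bubble_faithful`). The same action, together with a normal form, identifies the element of maximal
length of a parabolic submonoid with the product `w_P` above (`longest_eq_longestProd`).
-/

namespace ZeroHecke

/-! ### Longest elements of intervals -/

/-- A sequence of elements of a monoid that satisfies the relations of the `0`-Hecke monoid of
type `A`, with the infinitely many nodes `0, 1, 2, …`. -/
structure IsZeroHecke {M : Type*} [Monoid M] (p : ℕ → M) : Prop where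
  idem : ∀ i, p i * p i = p i
  comm : ∀ i j, i + 1 < j → p i * p j = p j * p i
  braid : ∀ i, p i * p (i + 1) * p i = p (i + 1) * p i * p (i + 1)

/-- The longest element of the parabolic submonoid of the interval `[a, a + n)`, by the recursion
`w_{P ∪ {k}} = w_P π_k w_P`. -/
def longestProd {M : Type*} [Monoid M] (p : ℕ → M) (a : ℕ) : ℕ → M
  | 0 => 1
  | n + 1 => longestProd p a n * p (a + n) * longestProd p a n

section Monoid

variable {M : Type*} [Monoid M] {p : ℕ → M}

theorem longestProd_congr {p q : ℕ → M} {a n : ℕ} (h : ∀ i, a ≤ i → i < a + n → p i = q i) :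
    longestProd p a n = longestProd q a n := by
  induction n with
  | zero => rfl
  | succ n ih =>
    simp only [longestProd]
    rw [ih fun i h1 h2 => h i h1 (by omega), h (a + n) (by omega) (by omega)]

theorem map_longestProd {M' F : Type*} [Monoid M'] [FunLike F M M'] [MonoidHomClass F M M']
    (f : F) (p : ℕ → M) (a n : ℕ) :
    f (longestProd p a n) = longestProd (fun i => f (p i)) a n := by
  induction n with
  | zero => simp [longestProd]
  | succ n ih => simp [longestProd, ih]

theorem longestProd_mem (S : Submonoid M) {a n : ℕ} (h : ∀ i, a ≤ i → i < a + n → p i ∈ S) :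
    longestProd p a n ∈ S := by
  induction n with
  | zero => exact S.one_mem
  | succ n ih =>
    have := ih fun i h1 h2 => h i h1 (by omega)
    exact S.mul_mem (S.mul_mem this (h _ (by omega) (by omega))) this

theorem longestProd_mul_of_absorb {a n : ℕ} {x : M}
    (h : ∀ i, a ≤ i → i < a + n → p i * x = x) : longestProd p a n * x = x := by
  induction n with
  | zero => simp [longestProd]
  | succ n ih =>
    have h1 := ih fun i h1 h2 => h i h1 (by omega)
    simp only [longestProd, mul_assoc]
    rw [h1, h _ (by omega) (by omega), h1]

theorem mul_longestProd_of_absorb {a n : ℕ} {x : M}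
    (h : ∀ i, a ≤ i → i < a + n → x * p i = x) : x * longestProd p a n = x := by
  induction n with
  | zero => simp [longestProd]
  | succ n ih =>
    have h1 := ih fun i h1 h2 => h i h1 (by omega)
    simp only [longestProd, ← mul_assoc]
    rw [h1, h _ (by omega) (by omega), h1]

theorem longestProd_commute {a n : ℕ} {x : M}
    (h : ∀ i, a ≤ i → i < a + n → Commute (p i) x) : Commute (longestProd p a n) x := by
  induction n with
  | zero => exact Commute.one_left x
  | succ n ih =>
    have h1 := ih fun i h1 h2 => h i h1 (by omega)
    exact (h1.mul_left (h _ (by omega) (by omega))).mul_left h1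

/-- The step that makes both recursions for longest elements work: if `w = v q v` absorbs `q` and `v`,
and `r` satisfies the braid relation with `q` and commutes with `v`, then `w r w` absorbs `r`. -/
theorem braid_absorb {v q w r : M} (hw : w = v * q * v) (hqr : q * r * q = r * q * r)
    (hvr : v * r = r * v) (hvw : v * w = w) (hqw : q * w = w) (hwv : w * v = w)
    (hwq : w * q = w) :
    r * (w * r * w) = w * r * w ∧ w * r * w * r = w * r * w := by
  have e1 : w * r * w = v * q * r * w := by
    calc w * r * w = v * q * (v * r) * w := by rw [hw]; simp only [mul_assoc]
      _ = v * q * r * (v * w) := by rw [hvr]; simp only [mul_assoc]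
      _ = v * q * r * w := by rw [hvw]
  have e2 : w * r * w = w * r * q * v := by
    calc w * r * w = w * (r * v) * q * v := by rw [hw]; simp only [mul_assoc]
      _ = (w * v) * r * q * v := by rw [← hvr]; simp only [mul_assoc]
      _ = w * r * q * v := by rw [hwv]
  constructor
  · calc r * (w * r * w) = r * w * (r * w) := by simp only [mul_assoc]
      _ = (r * v) * q * (v * r) * w := by rw [hw]; simp only [mul_assoc]
      _ = (v * r) * q * (r * v) * w := by rw [hvr]
      _ = v * (r * q * r) * (v * w) := by simp only [mul_assoc]
      _ = v * q * r * (q * w) := by rw [← hqr, hvw]; simp only [mul_assoc]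
      _ = w * r * w := by rw [hqw, e1]
  · calc w * r * w * r = w * (r * v) * q * (v * r) := by rw [hw]; simp only [mul_assoc]
      _ = w * (v * r) * q * (r * v) := by rw [hvr]
      _ = (w * v) * (r * q * r) * v := by simp only [mul_assoc]
      _ = (w * q) * r * q * v := by rw [← hqr, hwv]; simp only [mul_assoc]
      _ = w * r * w := by rw [hwq, e2]

theorem longestProd_absorb (hp : IsZeroHecke p) (a n : ℕ) :
    ∀ i, a ≤ i → i < a + n →
      p i * longestProd p a n = longestProd p a n ∧ longestProd p a n * p i = longestProd p a n := by
  induction n with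
  | zero => intro i h1 h2; omega
  | succ n ih =>
    intro i h1 h2
    rcases Nat.lt_or_ge i (a + n) with h3 | h3
    · obtain ⟨e1, e2⟩ := ih i h1 h3
      refine ⟨?_, ?_⟩
      · simp only [longestProd, ← mul_assoc, e1]
      · simp only [longestProd, mul_assoc, e2]
    · obtain rfl : i = a + n := by omega
      cases n with
      | zero => simp [longestProd, hp.idem]
      | succ m =>
        refine braid_absorb (v := longestProd p a m) (q := p (a + m)) rfl (hp.braid _) ?_ ?_ ?_ ?_ ?_
        · exact longestProd_commute fun i _ h => hp.comm i _ (by omega)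
        · exact longestProd_mul_of_absorb fun i h h' => (ih i h (by omega)).1
        · exact (ih _ (by omega) (by omega)).1
        · exact mul_longestProd_of_absorb fun i h h' => (ih i h (by omega)).2
        · exact (ih _ (by omega) (by omega)).2

theorem longestProd_idem (hp : IsZeroHecke p) (a n : ℕ) :
    longestProd p a n * longestProd p a n = longestProd p a n :=
  longestProd_mul_of_absorb fun i h h' => (longestProd_absorb hp a n i h h').1

theorem longestProd_mul_longestProd (hp : IsZeroHecke p) {a n b m : ℕ} (h : a ≤ b)
    (h' : b + m ≤ a + n) : longestProd p b m * longestProd p a n = longestProd p a n :=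
  longestProd_mul_of_absorb fun i h1 h2 => (longestProd_absorb hp a n i (by omega) (by omega)).1

theorem longestProd_mul_longestProd' (hp : IsZeroHecke p) {a n b m : ℕ} (h : a ≤ b)
    (h' : b + m ≤ a + n) : longestProd p a n * longestProd p b m = longestProd p a n :=
  mul_longestProd_of_absorb fun i h1 h2 => (longestProd_absorb hp a n i (by omega) (by omega)).2

/-- The mirror image of the defining recursion: both sides absorb the generators of the interval,
hence each other. -/
theorem longestProd_succ_left (hp : IsZeroHecke p) (a n : ℕ) :
    longestProd p a (n + 1) = longestProd p (a + 1) n * p a * longestProd p (a + 1) n := by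
  induction n generalizing a with
  | zero => simp [longestProd]
  | succ n ih =>
    have hx : ∀ i, a ≤ i → i < a + (n + 1 + 1) →
        p i * (longestProd p (a + 1) (n + 1) * p a * longestProd p (a + 1) (n + 1)) =
          longestProd p (a + 1) (n + 1) * p a * longestProd p (a + 1) (n + 1) ∧
        longestProd p (a + 1) (n + 1) * p a * longestProd p (a + 1) (n + 1) * p i =
          longestProd p (a + 1) (n + 1) * p a * longestProd p (a + 1) (n + 1) := by
      intro i h1 h2
      rcases Nat.eq_or_lt_of_le h1 with rfl | h3
      · refine braid_absorb (v := longestProd p (a + 1 + 1) n) (q := p (a + 1)) (ih _)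
          (hp.braid _).symm ?_ ?_ ?_ ?_ ?_
        · exact longestProd_commute fun i h _ => (hp.comm _ _ (by omega)).symm
        · exact longestProd_mul_longestProd hp (by omega) (by omega)
        · exact (longestProd_absorb hp _ _ _ (by omega) (by omega)).1
        · exact longestProd_mul_longestProd' hp (by omega) (by omega)
        · exact (longestProd_absorb hp _ _ _ (by omega) (by omega)).2
      · obtain ⟨e1, e2⟩ := longestProd_absorb hp (a + 1) (n + 1) i (by omega) (by omega)
        refine ⟨?_, ?_⟩
        · simp only [← mul_assoc, e1]
        · simp only [mul_assoc, e2]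
    have h1 := longestProd_mul_of_absorb fun i h h' => (hx i h h').1
    rw [← h1]
    simp only [← mul_assoc]
    rw [longestProd_mul_longestProd' hp (by omega) (by omega),
      (longestProd_absorb hp _ _ a (by omega) (by omega)).2,
      longestProd_mul_longestProd' hp (by omega) (by omega)]

/-- The product `π_j π_{j+1} ⋯ π_{j+l-1}`. -/
def ascProd {M : Type*} [Monoid M] (p : ℕ → M) : ℕ → ℕ → M
  | _, 0 => 1
  | j, l + 1 => p j * ascProd p (j + 1) l

theorem ascProd_succ (j l : ℕ) : ascProd p j (l + 1) = ascProd p j l * p (j + l) := by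
  induction l generalizing j with
  | zero => simp [ascProd]
  | succ l ih =>
    rw [ascProd, ih, ascProd, mul_assoc]
    congr 3
    omega

theorem ascProd_commute (hp : IsZeroHecke p) {i j : ℕ} (h : i + 1 < j) (l : ℕ) :
    Commute (p i) (ascProd p j l) := by
  induction l generalizing j with
  | zero => exact Commute.one_right _
  | succ l ih => exact Commute.mul_right (hp.comm i j h) (ih (by omega))

theorem mul_ascProd (hp : IsZeroHecke p) {i j l : ℕ} (h : j ≤ i) (h' : i + 1 < j + l) :
    p (i + 1) * ascProd p j l = ascProd p j l * p i := by
  induction l generalizing j with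
  | zero => omega
  | succ l ih =>
    rcases Nat.eq_or_lt_of_le h with rfl | h3
    · obtain ⟨l, rfl⟩ : ∃ m, l = m + 1 := ⟨l - 1, by omega⟩
      simp only [ascProd]
      calc p (j + 1) * (p j * (p (j + 1) * ascProd p (j + 1 + 1) l))
          = p (j + 1) * p j * p (j + 1) * ascProd p (j + 1 + 1) l := by simp only [mul_assoc]
        _ = p j * p (j + 1) * (p j * ascProd p (j + 1 + 1) l) := by
            rw [← hp.braid]; simp only [mul_assoc]
        _ = _ := by rw [(ascProd_commute hp (by omega) l).eq]; simp only [mul_assoc]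
    · rw [ascProd, ← mul_assoc, ← hp.comm j (i + 1) (by omega), mul_assoc, ih h3 (by omega),
        mul_assoc]

theorem ascProd_mul_absorb {a n : ℕ} {x : M}
    (h : ∀ i, a ≤ i → i < a + n → p i * x = x) : ascProd p a n * x = x := by
  induction n generalizing a with
  | zero => simp [ascProd]
  | succ n ih =>
    rw [ascProd, mul_assoc, ih fun i h1 h2 => h i (by omega) (by omega), h a le_rfl (by omega)]

theorem mul_ascProd_absorb {a n : ℕ} {x : M}
    (h : ∀ i, a ≤ i → i < a + n → x * p i = x) : x * ascProd p a n = x := by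
  induction n generalizing a with
  | zero => simp [ascProd]
  | succ n ih =>
    rw [ascProd, ← mul_assoc, h a le_rfl (by omega), ih fun i h1 h2 => h i (by omega) (by omega)]

theorem longestProd_eq_ascProd_mul (hp : IsZeroHecke p) (c n : ℕ) :
    longestProd p c (n + 1) = ascProd p c (n + 1) * longestProd p c n := by
  have h1 : longestProd p c (n + 1) * (ascProd p c (n + 1) * longestProd p c n) =
      ascProd p c (n + 1) * longestProd p c n := by
    refine longestProd_mul_of_absorb fun i h h' => ?_
    rcases Nat.eq_or_lt_of_le h with rfl | h3
    · rw [ascProd, ← mul_assoc, ← mul_assoc, hp.idem]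
    · obtain ⟨i, rfl⟩ : ∃ m, i = m + 1 := ⟨i - 1, by omega⟩
      rw [← mul_assoc, mul_ascProd hp (by omega) (by omega), mul_assoc,
        (longestProd_absorb hp c n i (by omega) (by omega)).1]
  rw [← h1, ← mul_assoc, mul_ascProd_absorb fun i h h' => (longestProd_absorb hp c _ i h h').2,
    longestProd_mul_longestProd' hp le_rfl (by omega)]

theorem longestProd_eq_mul_ascProd (hp : IsZeroHecke p) (c n : ℕ) :
    longestProd p c (n + 1) = longestProd p (c + 1) n * ascProd p c (n + 1) := by
  have h1 : longestProd p (c + 1) n * ascProd p c (n + 1) * longestProd p c (n + 1) =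
      longestProd p (c + 1) n * ascProd p c (n + 1) := by
    refine mul_longestProd_of_absorb fun i h h' => ?_
    rcases Nat.lt_or_ge i (c + n) with h3 | h3
    · rw [mul_assoc, ← mul_ascProd hp h (by omega), ← mul_assoc,
        (longestProd_absorb hp (c + 1) n (i + 1) (by omega) (by omega)).2]
    · obtain rfl : i = c + n := by omega
      rw [ascProd_succ, mul_assoc, mul_assoc, hp.idem]
  rw [← h1, mul_assoc, ascProd_mul_absorb fun i h h' => (longestProd_absorb hp c _ i h h').1,
    longestProd_mul_longestProd hp (by omega) (by omega)]

/-- The product of the longest elements of `[c + 1, c + n]` and `[c, c + n - 1]` is one letter away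
from the longest element of `[c, c + n]`: here the letter `c` is supplied on the left. -/
theorem mul_longestProd_mul_longestProd (hp : IsZeroHecke p) (c n : ℕ) :
    p c * (longestProd p (c + 1) n * longestProd p c n) = longestProd p c (n + 1) := by
  cases n with
  | zero => simp [longestProd]
  | succ n =>
    rw [longestProd_eq_ascProd_mul hp (c + 1) n, mul_assoc,
      longestProd_mul_longestProd hp (by omega) (by omega), longestProd_eq_ascProd_mul hp c (n + 1),
      ← mul_assoc]
    rfl

/-- The companion of `mul_longestProd_mul_longestProd` that supplies the letter `c + n` on the
right. -/
theorem longestProd_mul_longestProd_mul (hp : IsZeroHecke p) (c n : ℕ) :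
    longestProd p (c + 1) n * longestProd p c n * p (c + n) = longestProd p c (n + 1) := by
  cases n with
  | zero => simp [longestProd]
  | succ n =>
    rw [longestProd_eq_mul_ascProd hp c n, ← mul_assoc,
      longestProd_mul_longestProd' hp (by omega) (by omega), mul_assoc, ← ascProd_succ,
      ← longestProd_eq_mul_ascProd hp]

theorem IsZeroHecke.op (hp : IsZeroHecke p) : IsZeroHecke fun i => MulOpposite.op (p i) where
  idem i := by rw [← MulOpposite.op_mul, hp.idem]
  comm i j h := by rw [← MulOpposite.op_mul, ← MulOpposite.op_mul, hp.comm i j h]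
  braid i := by
    simp only [← MulOpposite.op_mul]
    rw [← mul_assoc, ← mul_assoc, hp.braid]

theorem longestProd_op (a n : ℕ) :
    longestProd (fun i => MulOpposite.op (p i)) a n = MulOpposite.op (longestProd p a n) := by
  induction n with
  | zero => rfl
  | succ n ih => simp only [longestProd, ih, ← MulOpposite.op_mul, mul_assoc]

theorem longestProd_mul_longestProd_mul' (hp : IsZeroHecke p) (c n : ℕ) :
    longestProd p c n * longestProd p (c + 1) n * p c = longestProd p c (n + 1) := by
  have h := mul_longestProd_mul_longestProd hp.op c n
  simp only [longestProd_op, ← MulOpposite.op_mul] at h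
  exact MulOpposite.op_injective h

theorem mul_longestProd_mul_longestProd' (hp : IsZeroHecke p) (c n : ℕ) :
    p (c + n) * (longestProd p c n * longestProd p (c + 1) n) = longestProd p c (n + 1) := by
  have h := longestProd_mul_longestProd_mul hp.op c n
  simp only [longestProd_op, ← MulOpposite.op_mul] at h
  exact MulOpposite.op_injective h

end Monoid

/-! ### Products of signed blocks and sibling rivalry -/

/-- The two families of generators `x true i = π_i` and `x false i = 1 - π_i`. -/
structure IsSignedZeroHecke {A : Type*} [Ring A] (x : Bool → ℕ → A) : Prop where
  isZeroHecke : ∀ ε, IsZeroHecke (x ε)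
  add_not : ∀ ε i, x ε i + x (!ε) i = 1

/-- The node that follows the blocks in the list `t`, when the first of them starts at `a`. A
block is given by its sign and by the number of its nodes, lowered by one. -/
def blocksEnd : ℕ → List (Bool × ℕ) → ℕ
  | a, [] => a
  | a, (_, n) :: t => blocksEnd (a + n + 1) t

/-- The element `L y R`, where `L` is the product of the longest elements of the blocks in the list
`t` from left to right and `R` is the product from right to left; the first block starts at `a`. -/
def sandwich {A : Type*} [Ring A] (x : Bool → ℕ → A) (y : A) : ℕ → List (Bool × ℕ) → A
  | _, [] => y
  | a, (ε, n) :: t =>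
    longestProd (x ε) a (n + 1) * sandwich x y (a + n + 1) t * longestProd (x ε) a (n + 1)

section Ring

variable {A : Type*} [Ring A] {x : Bool → ℕ → A}

theorem le_blocksEnd (a : ℕ) (t : List (Bool × ℕ)) : a ≤ blocksEnd a t := by
  induction t generalizing a with
  | nil => exact le_rfl
  | cons b t ih => exact le_trans (by omega) (ih (a + b.2 + 1))

theorem IsSignedZeroHecke.eq_one_sub (hx : IsSignedZeroHecke x) (ε : Bool) (i : ℕ) :
    x (!ε) i = 1 - x ε i :=
  eq_sub_of_add_eq' (hx.add_not ε i)

theorem IsSignedZeroHecke.mul_not (hx : IsSignedZeroHecke x) (ε : Bool) (i : ℕ) :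
    x ε i * x (!ε) i = 0 := by
  rw [hx.eq_one_sub, mul_sub, mul_one, (hx.isZeroHecke ε).idem, sub_self]

theorem IsSignedZeroHecke.not_mul (hx : IsSignedZeroHecke x) (ε : Bool) (i : ℕ) :
    x (!ε) i * x ε i = 0 := by
  rw [hx.eq_one_sub, sub_mul, one_mul, (hx.isZeroHecke ε).idem, sub_self]

theorem IsSignedZeroHecke.commute (hx : IsSignedZeroHecke x) (ε δ : Bool) {i j : ℕ}
    (h : i + 1 < j) : Commute (x ε i) (x δ j) := by
  have h1 : Commute (x ε i) (x ε j) := (hx.isZeroHecke ε).comm i j h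
  rcases Bool.eq_or_eq_not δ ε with rfl | rfl
  · exact h1
  · rw [hx.eq_one_sub]
    exact (Commute.one_right _).sub_right h1

theorem sandwich_commute (hx : IsSignedZeroHecke x) {δ : Bool} {i a : ℕ} {y : A}
    {t : List (Bool × ℕ)} (h : i + 1 < a) (hy : Commute (x δ i) y) :
    Commute (x δ i) (sandwich x y a t) := by
  induction t generalizing a with
  | nil => exact hy
  | cons b t ih =>
    have h1 : Commute (x δ i) (longestProd (x b.1) a (b.2 + 1)) :=
      (longestProd_commute fun j h1 _ => (hx.commute δ b.1 (by omega)).symm).symm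
    exact (h1.mul_right (ih (by omega))).mul_right h1

/-- The case of sibling rivalry without blocks: a braid relation brings `x ε (c + 1)` next to
`x (!ε) (c + 1)`. -/
theorem mul_sibling_mul_eq_zero (hx : IsSignedZeroHecke x) (ε δ : Bool) (c : ℕ) :
    x δ c * x ε (c + 1) * x δ c * x (!ε) (c + 1) * x δ c = 0 := by
  rcases Bool.eq_or_eq_not ε δ with rfl | rfl
  · rw [(hx.isZeroHecke ε).braid, mul_assoc _ (x ε (c + 1)), hx.mul_not]
    simp
  · simp only [Bool.not_not]
    rw [mul_assoc, mul_assoc, ← mul_assoc (x δ c) (x δ (c + 1)), (hx.isZeroHecke δ).braid,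
      mul_assoc, ← mul_assoc (x (!δ) (c + 1)), ← mul_assoc (x (!δ) (c + 1)), hx.not_mul]
    simp

/-- Adding a block to a pair `H`, `H'` with `y H y H' y = 0`, where `y` is the last generator of the
block: if `V` is the longest element of the block without its last node, then `W = V y V`. -/
theorem block_step {V y W H H' : A} (hW : W = V * y * V) (hWW : W * W = W) (hWV : W * V = W)
    (hVW : V * W = W) (hWy : W * y = W) (hyW : y * W = W) (hVH : Commute V H) (hVH' : Commute V H')
    (h : y * H * y * H' * y = 0) : W * H * W * (W * H' * W) = 0 := by
  calc W * H * W * (W * H' * W) = W * H * (W * W) * H' * W := by simp only [mul_assoc]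
    _ = W * (H * V) * y * (V * H') * W := by rw [hWW, hW]; simp only [mul_assoc]
    _ = (W * V) * H * y * H' * (V * W) := by
        rw [← hVH.eq, hVH'.eq]; simp only [mul_assoc]
    _ = (W * y) * H * y * H' * (y * W) := by rw [hWV, hVW, hWy, hyW]
    _ = W * (y * H * y * H' * y) * W := by simp only [mul_assoc]
    _ = 0 := by rw [h]; simp

/-- Extending the new block `W` by a node `p` of the same sign on its left; `U` is the longest
element of the extended block without its last node `y`, and `Z` that of the extended block. -/
theorem same_sign_step {p W U y Z H H' : A} (hpWU : p * (W * U) = Z) (hUWp : U * W * p = Z)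
    (hWpW : W * p * W = Z) (hZ : Z = U * y * U) (hZy : Z * y = Z) (hyZ : y * Z = Z)
    (hUH : Commute U H) (hUH' : Commute U H') (h : y * H * y * H' * y = 0) :
    p * (W * H * W) * p * (W * H' * W) * p = 0 := by
  calc p * (W * H * W) * p * (W * H' * W) * p
      = p * W * H * (W * p * W) * H' * W * p := by simp only [mul_assoc]
    _ = p * W * (H * U) * y * (U * H') * W * p := by rw [hWpW, hZ]; simp only [mul_assoc]
    _ = (p * (W * U)) * H * y * H' * (U * W * p) := by
        rw [← hUH.eq, hUH'.eq]; simp only [mul_assoc]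
    _ = (Z * y) * H * y * H' * (y * Z) := by rw [hpWU, hUWp, hZy, hyZ]
    _ = Z * (y * H * y * H' * y) * Z := by simp only [mul_assoc]
    _ = 0 := by rw [h]; simp

/-- Preceding the new block `W` by a node of the opposite sign, with generator `1 - p`. -/
theorem opposite_sign_step {p W U y Z H H' : A} (hpWU : p * (W * U) = Z) (hUWp : U * W * p = Z)
    (hWUy : W * U * y = Z) (hyUW : y * (U * W) = Z)
    (hWpW : W * p * W = Z) (hZ : Z = U * y * U)
    (hUH : Commute U H) (hUH' : Commute U H') (hW : W * H * W * (W * H' * W) = 0)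
    (hH : H * H' = 0) (h : (1 - y) * H * (1 - y) * H' * (1 - y) = 0) :
    (1 - p) * (W * H * W) * (1 - p) * (W * H' * W) * (1 - p) = 0 := by
  -- `p` completes `W U` to `Z` from the left, as `y` does from the right, so `1 - p` crosses `W U`
  -- to become `1 - y`.
  have e1 : (1 - p) * (W * U) = W * U * (1 - y) := by
    rw [sub_mul, mul_sub, hpWU, hWUy, one_mul, mul_one]
  have e2 : U * W * (1 - p) = (1 - y) * (U * W) := by
    rw [sub_mul, mul_sub, hUWp, hyUW, one_mul, mul_one]
  have e3 : (1 - y) * H * y * H' * (1 - y) = 0 := by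
    have : (1 - y) * H * y * H' * (1 - y) =
        (1 - y) * (H * H') * (1 - y) - (1 - y) * H * (1 - y) * H' * (1 - y) := by noncomm_ring
    rw [this, hH, h]
    simp
  -- In the middle, `W (1 - p) W = W - Z`, and the part with `W` vanishes by `hW`.
  calc (1 - p) * (W * H * W) * (1 - p) * (W * H' * W) * (1 - p)
      = (1 - p) * (W * H * W * (W * H' * W)) * (1 - p)
        - (1 - p) * W * H * (W * p * W) * H' * W * (1 - p) := by
        noncomm_ring
    _ = -((1 - p) * W * (H * U) * y * (U * H') * W * (1 - p)) := by
        rw [hW, hWpW, hZ]; simp only [mul_assoc, mul_zero, zero_mul, zero_sub]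
    _ = -((1 - p) * (W * U) * H * y * H' * (U * W * (1 - p))) := by
        rw [← hUH.eq, hUH'.eq]; simp only [mul_assoc]
    _ = -(W * U * ((1 - y) * H * y * H' * (1 - y)) * (U * W)) := by
        rw [e1, e2]; simp only [mul_assoc]
    _ = 0 := by rw [e3]; simp

/-- Sibling rivalry, in the form that carries its own induction on the blocks, from right to left:
the second part is what remains of the first one when a block is put in front. -/
theorem sandwich_mul_sandwich_aux (hx : IsSignedZeroHecke x) (ε : Bool) (t : List (Bool × ℕ))
    (a k : ℕ) (hk : k = blocksEnd a t) :
    sandwich x (x ε k) a t * sandwich x (x (!ε) k) a t = 0 ∧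
    ∀ (δ : Bool) (c : ℕ), c + 1 = a →
      x δ c * sandwich x (x ε k) a t * x δ c * sandwich x (x (!ε) k) a t * x δ c = 0 := by
  induction t generalizing a with
  | nil =>
    subst hk
    refine ⟨hx.mul_not ε _, ?_⟩
    rintro δ c rfl
    exact mul_sibling_mul_eq_zero hx ε δ c
  | cons b t ih =>
    obtain ⟨σ, n⟩ := b
    have hp := hx.isZeroHecke σ
    obtain ⟨ih1, ih2⟩ := ih (a + n + 1) hk
    have hkle : a + n + 1 ≤ k := hk ▸ le_blocksEnd (a + n + 1) t
    have hcomm (ε : Bool) (a' n' : ℕ) (h : a' + n' ≤ a + n) :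
        Commute (longestProd (x σ) a' n') (sandwich x (x ε k) (a + n + 1) t) :=
      longestProd_commute fun i _ _ => sandwich_commute hx (by omega) (hx.commute _ _ (by omega))
    have hfirst : sandwich x (x ε k) a ((σ, n) :: t) * sandwich x (x (!ε) k) a ((σ, n) :: t) = 0 :=
      block_step (V := longestProd (x σ) a n) (y := x σ (a + n)) rfl (longestProd_idem hp _ _)
        (longestProd_mul_longestProd' hp le_rfl (by omega))
        (longestProd_mul_longestProd hp le_rfl (by omega))
        (longestProd_absorb hp _ _ _ (by omega) (by omega)).2
        (longestProd_absorb hp _ _ _ (by omega) (by omega)).1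
        (hcomm _ _ _ le_rfl) (hcomm _ _ _ le_rfl) (ih2 σ _ rfl)
    refine ⟨hfirst, ?_⟩
    rintro δ c rfl
    rcases Bool.eq_or_eq_not δ σ with rfl | rfl
    · exact same_sign_step (U := longestProd (x δ) c (n + 1)) (y := x δ (c + (n + 1)))
        (mul_longestProd_mul_longestProd hp c (n + 1))
        (longestProd_mul_longestProd_mul' hp c (n + 1))
        (longestProd_succ_left hp c (n + 1)).symm rfl
        (longestProd_absorb hp _ _ _ (by omega) (by omega)).2
        (longestProd_absorb hp _ _ _ (by omega) (by omega)).1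
        (hcomm _ _ _ (by omega)) (hcomm _ _ _ (by omega)) (ih2 δ _ (by omega))
    · rw [hx.eq_one_sub]
      refine opposite_sign_step (U := longestProd (x σ) c (n + 1)) (y := x σ (c + (n + 1)))
        (mul_longestProd_mul_longestProd hp c (n + 1))
        (longestProd_mul_longestProd_mul' hp c (n + 1))
        (longestProd_mul_longestProd_mul hp c (n + 1))
        (mul_longestProd_mul_longestProd' hp c (n + 1))
        (longestProd_succ_left hp c (n + 1)).symm rfl
        (hcomm _ _ _ (by omega)) (hcomm _ _ _ (by omega)) hfirst ih1 ?_
      rw [← hx.eq_one_sub]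
      exact ih2 (!σ) _ (by omega)

end Ring

/-! ### Bubble sort -/

theorem end_mul_apply {α : Type*} (f g : Function.End α) (x : α) : (f * g) x = f (g x) :=
  rfl

/-- One step of bubble sort: the values at `k` and `k + 1` are put into decreasing order. -/
def bubble (k : ℕ) : Function.End (ℕ → ℕ) := fun f j =>
  if j = k then max (f k) (f (k + 1)) else if j = k + 1 then min (f k) (f (k + 1)) else f j

theorem bubble_apply (k : ℕ) (f : ℕ → ℕ) (j : ℕ) : bubble k f j =
    if j = k then max (f k) (f (k + 1)) else if j = k + 1 then min (f k) (f (k + 1)) else f j :=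
  rfl

theorem isZeroHecke_bubble : IsZeroHecke bubble where
  idem i := by
    funext f j
    simp only [end_mul_apply, bubble_apply]
    split_ifs <;> omega
  comm i k h := by
    funext f j
    simp only [end_mul_apply, bubble_apply]
    rw [if_neg (by omega : ¬ i = k), if_neg (by omega : ¬ i = k + 1),
      if_neg (by omega : ¬ i + 1 = k), if_neg (by omega : ¬ i + 1 = k + 1),
      if_neg (by omega : ¬ k = i), if_neg (by omega : ¬ k = i + 1),
      if_neg (by omega : ¬ k + 1 = i), if_neg (by omega : ¬ k + 1 = i + 1)]
    split_ifs <;> omega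
  braid i := by
    have h1 : ¬ i = i + 1 := by omega
    have h2 : ¬ i = i + 1 + 1 := by omega
    have h3 : ¬ i + 1 = i := by omega
    have h4 : ¬ i + 1 + 1 = i := by omega
    have h5 : ¬ i + 1 + 1 = i + 1 := by omega
    have h6 : ¬ i + 1 = i + 1 + 1 := by omega
    funext f j
    simp only [end_mul_apply, bubble_apply, h1, h2, h3, h4, h5, h6, if_true, if_false]
    split_ifs <;> omega

theorem bubble_of_not_lt {k : ℕ} {f : ℕ → ℕ} (h : ¬ f k < f (k + 1)) : bubble k f = f := by
  funext j
  rw [bubble_apply]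
  split_ifs <;> subst_vars <;> omega

theorem bubble_of_lt {k : ℕ} {f : ℕ → ℕ} (h : f k < f (k + 1)) (j : ℕ) :
    bubble k f j = f (Equiv.swap k (k + 1) j) := by
  rw [bubble_apply, Equiv.swap_apply_def]
  split_ifs <;> omega

/-- The pairs of positions in `[a, b]` at which `f` is strictly increasing. -/
def ascents (a b : ℕ) (f : ℕ → ℕ) : Finset (ℕ × ℕ) :=
  (Finset.Icc a b ×ˢ Finset.Icc a b).filter fun q => q.1 < q.2 ∧ f q.1 < f q.2

theorem mem_ascents {a b : ℕ} {f : ℕ → ℕ} {q : ℕ × ℕ} :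
    q ∈ ascents a b f ↔ a ≤ q.1 ∧ q.2 ≤ b ∧ q.1 < q.2 ∧ f q.1 < f q.2 := by
  simp only [ascents, Finset.mem_filter, Finset.mem_product, Finset.mem_Icc]
  constructor
  · rintro ⟨⟨⟨h1, h2⟩, h3, h4⟩, h5, h6⟩
    exact ⟨h1, h4, h5, h6⟩
  · rintro ⟨h1, h4, h5, h6⟩
    exact ⟨⟨⟨h1, by omega⟩, by omega, h4⟩, h5, h6⟩

/-- A step of bubble sort that moves something removes exactly one ascent. -/
theorem card_ascents_bubble {a b k : ℕ} {f : ℕ → ℕ} (ha : a ≤ k) (hb : k < b)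
    (h : f k < f (k + 1)) :
    (ascents a b (bubble k f)).card + 1 = (ascents a b f).card := by
  have hmem : (k, k + 1) ∈ ascents a b f := mem_ascents.2 ⟨ha, hb, by simp, h⟩
  rw [← Finset.card_erase_add_one hmem, add_left_inj]
  refine Finset.card_nbij' (fun q => (Equiv.swap k (k + 1) q.1, Equiv.swap k (k + 1) q.2))
    (fun q => (Equiv.swap k (k + 1) q.1, Equiv.swap k (k + 1) q.2)) ?_ ?_ ?_ ?_
  · rintro ⟨i, j⟩ hq
    simp only [Finset.mem_coe, mem_ascents, Finset.mem_erase, bubble_of_lt h] at hq ⊢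
    obtain ⟨h1, h2, h3, h4⟩ := hq
    refine ⟨?_, ?_, ?_, ?_, h4⟩
    · rw [Ne, Prod.mk.injEq]
      rintro ⟨h5, h6⟩
      rw [Equiv.swap_apply_eq_iff, Equiv.swap_apply_left] at h5
      rw [Equiv.swap_apply_eq_iff, Equiv.swap_apply_right] at h6
      omega
    all_goals
      have h7 : ¬ (i = k ∧ j = k + 1) := by
        rintro ⟨rfl, rfl⟩
        rw [Equiv.swap_apply_left, Equiv.swap_apply_right] at h4
        omega
      clear h4
      simp only [Equiv.swap_apply_def]
      split_ifs <;> omega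
  · rintro ⟨i, j⟩ hq
    simp only [Finset.mem_coe, mem_ascents, Finset.mem_erase, bubble_of_lt h, Ne, Prod.mk.injEq,
      Equiv.swap_apply_self] at hq ⊢
    obtain ⟨h0, h1, h2, h3, h4⟩ := hq
    refine ⟨?_, ?_, ?_, h4⟩
    all_goals
      clear h4
      simp only [Equiv.swap_apply_def]
      split_ifs <;> omega
  · rintro ⟨i, j⟩ -
    simp
  · rintro ⟨i, j⟩ -
    simp

theorem card_ascents_id (a n : ℕ) :
    (ascents a (a + n) id).card = ∑ m ∈ Finset.range (n + 1), m := by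
  induction n with
  | zero =>
    simp only [zero_add, Finset.range_one, Finset.sum_singleton, Finset.card_eq_zero]
    ext q
    simp only [mem_ascents, Finset.notMem_empty, iff_false]
    omega
  | succ n ih =>
    rw [Finset.sum_range_succ, ← ih]
    have h1 : ascents a (a + (n + 1)) id = ascents a (a + n) id ∪
        (Finset.Ico a (a + (n + 1))).image fun i => (i, a + (n + 1)) := by
      ext ⟨i, j⟩
      simp only [mem_ascents, Finset.mem_union, Finset.mem_image, Finset.mem_Ico, Prod.mk.injEq, id]
      constructor
      · rintro ⟨h1, h2, h3, -⟩
        rcases Nat.lt_or_ge (a + n) j with h | h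
        · exact Or.inr ⟨i, by omega, rfl, by omega⟩
        · exact Or.inl ⟨h1, h, h3, h3⟩
      · rintro (h | ⟨i', h1, h2, h3⟩) <;> omega
    have h2 : Disjoint (ascents a (a + n) id)
        ((Finset.Ico a (a + (n + 1))).image fun i => (i, a + (n + 1))) := by
      rw [Finset.disjoint_left]
      rintro ⟨i, j⟩ h h'
      simp only [mem_ascents, Finset.mem_image, Finset.mem_Ico, Prod.mk.injEq] at h h'
      omega
    rw [h1, Finset.card_union_of_disjoint h2, Finset.card_image_of_injective _ fun i j h => by
      simpa using h, Nat.card_Ico, Nat.add_sub_cancel_left]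

theorem bubble_ascProd (j l : ℕ) (f : ℕ → ℕ) (h : ∀ i, j ≤ i → i < j + l → f i < f (j + l)) :
    ascProd bubble j l f = fun i =>
      if i < j then f i else if i = j then f (j + l) else if i ≤ j + l then f (i - 1) else f i := by
  induction l generalizing j with
  | zero =>
    funext i
    simp only [ascProd, Function.End.one_def, id]
    split_ifs <;> first | rfl | omega | congr 1
  | succ l ih =>
    have e : j + 1 + l = j + (l + 1) := by omega
    rw [ascProd, end_mul_apply, ih (j + 1) fun i h1 h2 => by
      rw [e]; exact h i (by omega) (by omega)]
    have hj := h j le_rfl (by omega)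
    rw [← e] at hj ⊢
    funext i
    rw [bubble_apply]
    rcases lt_trichotomy i j with h1 | rfl | h1
    · simp [h1.ne, h1, show i ≠ j + 1 by omega, show i < j + 1 by omega]
    · simp [hj.le]
    · by_cases h2 : i = j + 1
      · subst h2
        simp [hj.le, show j + 1 ≤ j + 1 + l by omega]
      · simp [h1.ne', h2, show ¬ i < j by omega, show ¬ i < j + 1 by omega]

/-! ### Normal forms -/

section NormalForm

variable {M : Type*} [Monoid M] {p : ℕ → M}

/-- Every product of the generators `a, …, a + n` can be written as `π_j ⋯ π_{a+n} x` with `x` a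
product of the generators `a, …, a + n - 1`. -/
theorem exists_eq_ascProd_mul (hp : IsZeroHecke p) {a n : ℕ} {y : M}
    (hy : y ∈ Submonoid.closure (p '' Set.Ico a (a + (n + 1)))) :
    ∃ j l, ∃ x ∈ Submonoid.closure (p '' Set.Ico a (a + n)),
      a ≤ j ∧ j + l = a + (n + 1) ∧ y = ascProd p j l * x := by
  induction hy using Submonoid.closure_induction_left with
  | one => exact ⟨a + (n + 1), 0, 1, Submonoid.one_mem _, by omega, rfl, by simp [ascProd]⟩
  | mul_left g hg y _ ih =>
    obtain ⟨i, ⟨hi1, hi2⟩, rfl⟩ := hg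
    obtain ⟨j, l, x, hx, h1, h2, rfl⟩ := ih
    have hmul (k : ℕ) (hk1 : a ≤ k) (hk2 : k < a + n) :
        p k * x ∈ Submonoid.closure (p '' Set.Ico a (a + n)) :=
      Submonoid.mul_mem _ (Submonoid.subset_closure ⟨k, ⟨hk1, hk2⟩, rfl⟩) hx
    rcases Nat.lt_or_ge (i + 1) j with h | h
    · exact ⟨j, l, p i * x, hmul i hi1 (by omega), h1, h2, by
        rw [← mul_assoc, (ascProd_commute hp h l).eq, mul_assoc]⟩
    rcases Nat.eq_or_lt_of_le h with rfl | h
    · exact ⟨i, l + 1, x, hx, hi1, by omega, by rw [ascProd, mul_assoc]⟩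
    rcases Nat.eq_or_lt_of_le (Nat.le_of_lt_succ h) with rfl | h
    · refine ⟨j, l, x, hx, h1, h2, ?_⟩
      obtain ⟨l, rfl⟩ : ∃ m, l = m + 1 := ⟨l - 1, by omega⟩
      rw [ascProd, ← mul_assoc, ← mul_assoc, hp.idem]
    · obtain ⟨i, rfl⟩ : ∃ m, i = m + 1 := ⟨i - 1, by omega⟩
      exact ⟨j, l, p i * x, hmul i (by omega) (by omega), h1, h2, by
        rw [← mul_assoc, mul_ascProd hp (by omega) (by omega), mul_assoc]⟩

theorem exists_word_ascProd (p : ℕ → M) (j l : ℕ) :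
    ∃ w : List ℕ, w.length = l ∧ (w.map p).prod = ascProd p j l := by
  induction l generalizing j with
  | zero => exact ⟨[], rfl, rfl⟩
  | succ l ih =>
    obtain ⟨w, h1, h2⟩ := ih (j + 1)
    exact ⟨j :: w, by simp [h1], by simp [h2, ascProd]⟩

/-- The normal form has at most as many letters as the interval has subintervals, and only the
longest element attains this bound. -/
theorem exists_word (hp : IsZeroHecke p) {a n : ℕ} {y : M}
    (hy : y ∈ Submonoid.closure (p '' Set.Ico a (a + n))) :
    ∃ w : List ℕ, (w.map p).prod = y ∧ w.length ≤ ∑ m ∈ Finset.range (n + 1), m ∧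
      (w.length = ∑ m ∈ Finset.range (n + 1), m → y = longestProd p a n) := by
  induction n generalizing y with
  | zero =>
    have : y = 1 := by simpa using hy
    exact ⟨[], by simp [this], by simp, fun _ => this⟩
  | succ n ih =>
    obtain ⟨j, l, x, hx, h1, h2, rfl⟩ := exists_eq_ascProd_mul hp hy
    obtain ⟨w, h3, h4, h5⟩ := ih hx
    obtain ⟨v, h6, h7⟩ := exists_word_ascProd p j l
    rw [Finset.sum_range_succ]
    refine ⟨v ++ w, by simp [h3, h7], by simp only [List.length_append]; omega, fun h => ?_⟩
    rw [List.length_append] at h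
    rw [h5 (by omega), longestProd_eq_ascProd_mul hp]
    congr 2 <;> omega

theorem map_ascProd {M' : Type*} [Monoid M'] (φ : M →* M') {q : ℕ → M'} {j l : ℕ}
    (h : ∀ i, j ≤ i → i < j + l → φ (p i) = q i) : φ (ascProd p j l) = ascProd q j l := by
  induction l generalizing j with
  | zero => exact map_one φ
  | succ l ih =>
    rw [ascProd, map_mul, h j le_rfl (by omega), ih fun i h1 h2 => h i (by omega) (by omega),
      ascProd]

/-- Bubble sort at the positions up to `n` does not touch the values that follow. -/
theorem bubble_closure_id (φ : M →* Function.End (ℕ → ℕ)) {n : ℕ}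
    (hφ : ∀ i < n, φ (p i) = bubble i) {x : M} (hx : x ∈ Submonoid.closure (p '' Set.Ico 0 n)) :
    (∀ i, n < i → φ x id i = i) ∧ ∀ i ≤ n, φ x id i ≤ n := by
  induction hx using Submonoid.closure_induction_left with
  | one => simp [Function.End.one_def]
  | mul_left g hg y _ ih =>
    obtain ⟨k, ⟨-, hk⟩, rfl⟩ := hg
    obtain ⟨h1, h2⟩ := ih
    rw [map_mul, hφ k hk, end_mul_apply]
    refine ⟨fun i hi => ?_, fun i hi => ?_⟩
    · rw [bubble_apply, if_neg (by omega), if_neg (by omega), h1 i hi]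
    · have h3 := h2 k (by omega)
      have h4 := h2 (k + 1) (by omega)
      have h5 := h2 i hi
      rw [bubble_apply]
      split_ifs <;> omega

/-- The bubble sort action is faithful: the normal form of an element can be read off from its
effect on the identity, since `π_j ⋯ π_n` moves the largest value to the position `j`. -/
theorem bubble_faithful (hp : IsZeroHecke p) (φ : M →* Function.End (ℕ → ℕ)) {n : ℕ}
    (hφ : ∀ i < n, φ (p i) = bubble i) {x y : M}
    (hx : x ∈ Submonoid.closure (p '' Set.Ico 0 n)) (hy : y ∈ Submonoid.closure (p '' Set.Ico 0 n))
    (h : φ x id = φ y id) : x = y := by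
  induction n generalizing x y with
  | zero =>
    have h1 : x = 1 := by simpa using hx
    have h2 : y = 1 := by simpa using hy
    rw [h1, h2]
  | succ n ih =>
    rw [← zero_add (n + 1)] at hx hy
    obtain ⟨j, l, x, hx', -, h2, rfl⟩ := exists_eq_ascProd_mul hp hx
    obtain ⟨j', l', y, hy', -, h2', rfl⟩ := exists_eq_ascProd_mul hp hy
    rw [zero_add] at hx' hy'
    have key (j l : ℕ) (h2 : j + l = 0 + (n + 1)) (x : M)
        (hx : x ∈ Submonoid.closure (p '' Set.Ico 0 n)) :
        φ (ascProd p j l * x) id = fun i => if i < j then φ x id i else if i = j then n + 1 else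
          if i ≤ n + 1 then φ x id (i - 1) else φ x id i := by
      obtain ⟨hx1, hx2⟩ := bubble_closure_id φ (fun i hi => hφ i (by omega)) hx
      rw [map_mul, end_mul_apply, map_ascProd φ fun i _ h1 => hφ i (by omega),
        bubble_ascProd, h2, zero_add, hx1 (n + 1) (by omega)]
      intro i h3 h4
      rw [h2, zero_add, hx1 (n + 1) (by omega)]
      exact Nat.lt_succ_of_le (hx2 i (by omega))
    rw [key j l h2 x hx', key j' l' h2' y hy'] at h
    obtain ⟨hx1, hx2⟩ := bubble_closure_id φ (fun i hi => hφ i (by omega)) hx'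
    obtain ⟨hy1, hy2⟩ := bubble_closure_id φ (fun i hi => hφ i (by omega)) hy'
    have hj : j = j' := by
      have e1 := congrFun h j
      have e3 := hy2 j
      have e4 := hy2 (j - 1)
      simp only [lt_irrefl, if_false, if_true] at e1
      split_ifs at e1 <;> omega
    subst hj
    obtain rfl : l = l' := by omega
    congr 1
    refine ih (fun i hi => hφ i (by omega)) hx' hy' ?_
    funext i
    rcases Nat.lt_or_ge n i with h3 | h3
    · rw [hx1 i h3, hy1 i h3]
    rcases Nat.lt_or_ge i j with h4 | h4
    · have e1 := congrFun h i
      simpa [h4] using e1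
    · have e1 := congrFun h (i + 1)
      simpa [show ¬ i + 1 < j by omega, show ¬ i + 1 = j by omega, h3] using e1

theorem IsZeroHecke.restrict (hp : IsZeroHecke p) (P : ℕ → Prop) [DecidablePred P] :
    IsZeroHecke fun i => if P i then p i else 1 where
  idem i := by split_ifs <;> simp [hp.idem]
  comm i j h := by split_ifs <;> simp [hp.comm i j h]
  braid i := by split_ifs <;> simp [hp.idem, hp.braid i]

end NormalForm

/-! ### The longest element of a parabolic submonoid -/

section Longest

variable {N : ℕ}

/-- The homomorphism from the `0`-Hecke monoid given by elements that satisfy its relations. -/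
def heckeLift {M : Type*} [Monoid M] {q : ℕ → M} (hq : IsZeroHecke q) (N : ℕ) :
    HeckeMonoid N →* M :=
  PresentedMonoid.lift (fun i : Fin (N - 1) => q i) (by
    intro u v h
    cases h with
    | idem i => simpa using hq.idem i
    | comm i j h => simpa using hq.comm i j h
    | braid i j h => simpa [← h] using hq.braid i)

theorem heckeLift_gen {M : Type*} [Monoid M] {q : ℕ → M} (hq : IsZeroHecke q) (i : Fin (N - 1)) :
    heckeLift hq N (gen i) = q i :=
  rfl

/-- The generators of `H_0(S_N)`, continued by `1` to all natural numbers. -/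
def natGen (N : ℕ) (i : ℕ) : HeckeMonoid N :=
  if h : i < N - 1 then gen ⟨i, h⟩ else 1

theorem natGen_val (i : Fin (N - 1)) : natGen N i = gen i :=
  dif_pos i.2

theorem natGen_of_lt {i : ℕ} (h : i < N - 1) : natGen N i = gen ⟨i, h⟩ :=
  dif_pos h

theorem natGen_of_not_lt {i : ℕ} (h : ¬ i < N - 1) : natGen N i = 1 :=
  dif_neg h

theorem natGen_idem (N i : ℕ) : natGen N i * natGen N i = natGen N i := by
  by_cases h : i < N - 1
  · rw [natGen_of_lt h, gen_idem]
  · rw [natGen_of_not_lt h, one_mul]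

theorem isZeroHecke_natGen (N : ℕ) : IsZeroHecke (natGen N) where
  idem := natGen_idem N
  comm i j h := by
    by_cases hj : j < N - 1
    · rw [natGen_of_lt hj, natGen_of_lt (show i < N - 1 by omega)]
      exact gen_comm _ _ h
    · rw [natGen_of_not_lt hj, mul_one, one_mul]
  braid i := by
    by_cases hj : i + 1 < N - 1
    · rw [natGen_of_lt hj, natGen_of_lt (show i < N - 1 by omega)]
      exact gen_braid _ _ rfl
    · rw [natGen_of_not_lt hj, mul_one, one_mul, mul_one, natGen_idem]

theorem exists_word_gen (w : List ℕ) :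
    ∃ v : List (Fin (N - 1)), v.length ≤ w.length ∧ (v.map gen).prod = (w.map (natGen N)).prod := by
  induction w with
  | nil => exact ⟨[], le_rfl, rfl⟩
  | cons i w ih =>
    obtain ⟨v, h1, h2⟩ := ih
    by_cases h : i < N - 1
    · exact ⟨⟨i, h⟩ :: v, by simpa using h1, by simp [h2, natGen, h]⟩
    · exact ⟨v, by simp; omega, by simp [h2, natGen, h]⟩

theorem length_le_of_prod (w : List ℕ) : length (w.map (natGen N)).prod ≤ w.length := by
  obtain ⟨v, h1, h2⟩ := exists_word_gen (N := N) w
  exact le_trans (Nat.sInf_le ⟨v, rfl, h2⟩) h1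

theorem closure_natGen_eq_top : Submonoid.closure (natGen N '' Set.Ico 0 (N - 1)) = ⊤ := by
  rw [eq_top_iff, ← PresentedMonoid.closure_range_of (Rel N), Submonoid.closure_le]
  rintro _ ⟨i, rfl⟩
  exact Submonoid.subset_closure ⟨i, ⟨by omega, i.2⟩, natGen_val i⟩

theorem parabolic_eq_closure {J : Set (Fin (N - 1))} {a n : ℕ} (h : a + n ≤ N - 1)
    (hJ : ∀ i, i ∈ J ↔ a ≤ (i : ℕ) ∧ (i : ℕ) < a + n) :
    parabolic J = Submonoid.closure (natGen N '' Set.Ico a (a + n)) := by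
  unfold parabolic
  congr 1
  ext y
  constructor
  · rintro ⟨i, hi, rfl⟩
    exact ⟨i, (hJ i).1 hi, natGen_val i⟩
  · rintro ⟨i, ⟨h1, h2⟩, rfl⟩
    exact ⟨⟨i, by omega⟩, (hJ _).2 ⟨h1, h2⟩, (natGen_val _).symm⟩

/-- Each letter of a word removes at most one ascent, and the longest element of the interval
`[a, a + n)` has to remove all ascents in `[a, a + n]`. -/
theorem le_length_longestProd {a n : ℕ} (h : a + n ≤ N - 1) :
    ∑ m ∈ Finset.range (n + 1), m ≤ length (longestProd (natGen N) a n) := by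
  have hne : {k | ∃ w : List (Fin (N - 1)), w.length = k ∧
      (w.map gen).prod = longestProd (natGen N) a n}.Nonempty := by
    have : longestProd (natGen N) a n ∈
        Submonoid.closure (natGen N '' Set.Ico 0 (0 + (N - 1))) := by
      rw [Nat.zero_add, closure_natGen_eq_top]
      trivial
    obtain ⟨w, hw, -⟩ := exists_word (isZeroHecke_natGen N) this
    obtain ⟨v, -, hv⟩ := exists_word_gen (N := N) w
    exact ⟨_, v, rfl, hv.trans hw⟩
  refine le_csInf hne ?_
  rintro _ ⟨w, rfl, hw⟩
  have hq := isZeroHecke_bubble.restrict fun i => a ≤ i ∧ i < a + n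
  set φ := heckeLift hq N with hφ
  have hφn (i : ℕ) (h1 : a ≤ i) (h2 : i < a + n) : φ (natGen N i) = bubble i := by
    have := heckeLift_gen hq (N := N) ⟨i, by omega⟩
    rw [← natGen_val] at this
    exact this.trans (if_pos ⟨h1, h2⟩)
  have hle : ∀ (w : List (Fin (N - 1))) (f : ℕ → ℕ),
      (ascents a (a + n) f).card ≤ (ascents a (a + n) (φ (w.map gen).prod f)).card + w.length := by
    intro w f
    induction w with
    | nil => simp [Function.End.one_def]
    | cons i w ih =>
      rw [List.map_cons, List.prod_cons, map_mul, end_mul_apply, heckeLift_gen, List.length_cons]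
      set g := φ (w.map gen).prod f
      split_ifs with h1
      · by_cases h2 : g i < g (i + 1)
        · have := card_ascents_bubble h1.1 h1.2 h2
          omega
        · rw [bubble_of_not_lt h2]
          omega
      · rw [Function.End.one_def, id]
        omega
  have h1 := hle w id
  rw [card_ascents_id, hw] at h1
  suffices h2 : ascents a (a + n) (φ (longestProd (natGen N) a n) id) = ∅ by
    rw [h2, Finset.card_empty] at h1
    omega
  set g := φ (longestProd (natGen N) a n) id
  have hstep : ∀ k, a ≤ k → k < a + n → g (k + 1) ≤ g k := by
    intro k h2 h3
    have h4 : bubble k g = g := by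
      have := (longestProd_absorb (isZeroHecke_natGen N) a n k h2 h3).1
      have h5 : φ (natGen N k * longestProd (natGen N) a n) id = g := by rw [this]
      rwa [map_mul, hφn k h2 h3] at h5
    have h5 := congrFun h4 k
    rw [bubble_apply, if_pos rfl] at h5
    omega
  have hanti : ∀ i d, a ≤ i → i + d ≤ a + n → g (i + d) ≤ g i := by
    intro i d h2
    induction d with
    | zero => intro; exact le_rfl
    | succ d ih =>
      intro h3
      exact (hstep (i + d) (by omega) (by omega)).trans (ih (by omega))
  refine Finset.eq_empty_of_forall_notMem fun q hq => ?_
  obtain ⟨h2, h3, h4, h5⟩ := mem_ascents.1 hq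
  have := hanti q.1 (q.2 - q.1) h2 (by omega)
  rw [Nat.add_sub_cancel' h4.le] at this
  omega

theorem longest_eq_longestProd {J : Set (Fin (N - 1))} {a n : ℕ} (h : a + n ≤ N - 1)
    (hJ : ∀ i, i ∈ J ↔ a ≤ (i : ℕ) ∧ (i : ℕ) < a + n) :
    longest J = longestProd (natGen N) a n := by
  have hmem : longestProd (natGen N) a n ∈ parabolic J := by
    rw [parabolic_eq_closure h hJ]
    exact longestProd_mem _ fun i h1 h2 => Submonoid.subset_closure ⟨i, ⟨h1, h2⟩, rfl⟩
  have key : ∀ y ∈ parabolic J, y = longestProd (natGen N) a n ∨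
      length y < length (longestProd (natGen N) a n) := by
    intro y hy
    rw [parabolic_eq_closure h hJ] at hy
    obtain ⟨w, rfl, h2, h3⟩ := exists_word (isZeroHecke_natGen N) hy
    rcases Nat.eq_or_lt_of_le h2 with h4 | h4
    · exact Or.inl (h3 h4)
    · exact Or.inr (((length_le_of_prod w).trans_lt h4).trans_le (le_length_longestProd h))
  have hlong : IsLongest J (longestProd (natGen N) a n) := by
    refine ⟨hmem, fun y hy => ?_⟩
    rcases key y hy with rfl | h1
    · exact le_rfl
    · exact h1.le
  have hspec : IsLongest J (longest J) := Classical.epsilon_spec ⟨_, hlong⟩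
  rcases key _ hspec.1 with h1 | h1
  · exact h1
  · exact absurd (hspec.2 _ hmem) (not_le.2 h1)

end Longest

/-! ### Characters and idempotents -/

section Character

variable {N : ℕ}

theorem isZeroHecke_of_comm {M : Type*} [CommMonoid M] {q : ℕ → M} (h : ∀ i, q i * q i = q i) :
    IsZeroHecke q where
  idem := h
  comm i j _ := mul_comm _ _
  braid i := by
    rw [mul_right_comm, h, mul_right_comm, h, mul_comm]

/-- The values of the character `χ_D` on the generators. -/
def charValue (D : SignedDiagram N) (i : ℕ) : ℂ :=
  if h : i < N - 1 then if D ⟨i, h⟩ then 1 else 0 else 0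

theorem charValue_idem (D : SignedDiagram N) (i : ℕ) :
    charValue D i * charValue D i = charValue D i := by
  unfold charValue
  split_ifs <;> simp

/-- The restriction of `χ_D` to the `0`-Hecke monoid. -/
noncomputable def monoidChar (D : SignedDiagram N) : HeckeMonoid N →* ℂ :=
  heckeLift (isZeroHecke_of_comm (charValue_idem D)) N

theorem monoidChar_gen (D : SignedDiagram N) (i : Fin (N - 1)) :
    monoidChar D (gen i) = if D i then 1 else 0 := by
  rw [monoidChar, heckeLift_gen, charValue, dif_pos i.2]

/-- The character `χ_D` of the `0`-Hecke algebra: it takes `π_i` to `1` if the node `i` has the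
sign `+` in `D`, and to `0` otherwise. -/
noncomputable def heckeChar (D : SignedDiagram N) : HeckeAlgebra N →ₐ[ℂ] ℂ :=
  MonoidAlgebra.lift ℂ ℂ (HeckeMonoid N) (monoidChar D)

theorem heckeChar_of (D : SignedDiagram N) (x : HeckeMonoid N) :
    heckeChar D (MonoidAlgebra.of ℂ (HeckeMonoid N) x) = monoidChar D x := by
  simp [heckeChar]

/-- The bubble sort action of the `0`-Hecke monoid. -/
def bubbleAction (N : ℕ) : HeckeMonoid N →* Function.End (ℕ → ℕ) :=
  heckeLift isZeroHecke_bubble N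

theorem bubbleAction_injective {x y : HeckeMonoid N}
    (h : bubbleAction N x id = bubbleAction N y id) : x = y := by
  refine bubble_faithful (isZeroHecke_natGen N) (bubbleAction N) (n := N - 1) ?_ ?_ ?_ h
  · intro i hi
    rw [natGen_of_lt hi]
    rfl
  all_goals
    rw [closure_natGen_eq_top]
    trivial

/-- The number of inversions that are missing in the permutation of an element of `H_0(S_N)`. -/
def colength (y : HeckeMonoid N) : ℕ :=
  (ascents 0 (N - 1) (bubbleAction N y id)).card

/-- A generator either fixes an element of `H_0(S_N)` or lowers its colength. That an element is
fixed can be tested on the permutation, by faithfulness. -/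
theorem gen_mul_eq_or_colength_lt (i : Fin (N - 1)) (y : HeckeMonoid N) :
    gen i * y = y ∨ colength (gen i * y) < colength y := by
  have h1 : bubbleAction N (gen i * y) id = bubble i (bubbleAction N y id) := by
    rw [map_mul, end_mul_apply]
    rfl
  by_cases h : bubbleAction N y id i < bubbleAction N y id (i + 1)
  · right
    have := card_ascents_bubble (Nat.zero_le i) i.2 h
    rw [colength, colength, h1]
    omega
  · left
    apply bubbleAction_injective
    rw [h1, bubble_of_not_lt h]

open Classical in
/-- The signed diagram of the left descents of an element. -/
noncomputable def descents (y : HeckeMonoid N) : SignedDiagram N :=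
  fun i => decide (gen i * y = y)

theorem monoidChar_descents (x y : HeckeMonoid N) :
    (monoidChar (descents y) x = 1 ∧ x * y = y) ∨
      (monoidChar (descents y) x = 0 ∧ colength (x * y) < colength y) := by
  have hx : x ∈ Submonoid.closure (Set.range (PresentedMonoid.of (Rel N))) := by
    rw [PresentedMonoid.closure_range_of]
    trivial
  induction hx using Submonoid.closure_induction_left with
  | one => simp
  | mul_left g hg x _ ih =>
    obtain ⟨i, rfl⟩ := hg
    change (monoidChar (descents y) (gen i * x) = 1 ∧ gen i * x * y = y) ∨
      (monoidChar (descents y) (gen i * x) = 0 ∧ colength (gen i * x * y) < colength y)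
    rw [map_mul, mul_assoc]
    rcases ih with ⟨h1, h2⟩ | ⟨h1, h2⟩
    · rw [h1, h2, monoidChar_gen]
      by_cases h : gen i * y = y
      · left
        simp [descents, h]
      · right
        have := (gen_mul_eq_or_colength_lt i y).resolve_left h
        simp [descents, h, this]
    · right
      rw [h1, mul_zero]
      refine ⟨rfl, ?_⟩
      rcases gen_mul_eq_or_colength_lt i (x * y) with h | h
      · rwa [h]
      · exact h.trans h2

/-- The span of the elements of `H_0(S_N)` of colength less than `n`. -/
noncomputable def colengthFiltration (N n : ℕ) : Submodule ℂ (HeckeAlgebra N) :=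
  Submodule.span ℂ (MonoidAlgebra.of ℂ (HeckeMonoid N) '' {y | colength y < n})

/-- Left multiplication is triangular in the basis `H_0(S_N)`, with the characters on the
diagonal. -/
theorem mul_of_sub_mem (f : HeckeAlgebra N) (y : HeckeMonoid N) :
    f * MonoidAlgebra.of ℂ (HeckeMonoid N) y -
      heckeChar (descents y) f • MonoidAlgebra.of ℂ (HeckeMonoid N) y ∈
        colengthFiltration N (colength y) := by
  induction f using MonoidAlgebra.induction_on with
  | of x =>
    rw [heckeChar_of, ← map_mul]
    rcases monoidChar_descents x y with ⟨h1, h2⟩ | ⟨h1, h2⟩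
    · rw [h1, h2, one_smul, sub_self]
      exact Submodule.zero_mem _
    · rw [h1, zero_smul, sub_zero]
      exact Submodule.subset_span ⟨_, h2, rfl⟩
  | add f g hf hg =>
    rw [add_mul, map_add, add_smul, add_sub_add_comm]
    exact Submodule.add_mem _ hf hg
  | smul r f hf =>
    rw [smul_mul_assoc, map_smul, smul_assoc, ← smul_sub]
    exact Submodule.smul_mem _ r hf

/-- An idempotent in the kernel of all characters lowers the colength filtration, so it is
nilpotent. -/
theorem eq_zero_of_heckeChar_eq_zero {f : HeckeAlgebra N} (hf : IsIdempotentElem f)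
    (h : ∀ D, heckeChar D f = 0) : f = 0 := by
  have key : ∀ n, ∀ v ∈ colengthFiltration N n, f * v = 0 := by
    intro n
    induction n with
    | zero =>
      intro v hv
      have : v = 0 := by simpa [colengthFiltration] using hv
      rw [this, mul_zero]
    | succ n ih =>
      intro v hv
      induction hv using Submodule.span_induction with
      | mem v hv =>
        obtain ⟨y, hy, rfl⟩ := hv
        have h1 := mul_of_sub_mem f y
        rw [h, zero_smul, sub_zero] at h1
        have h2 : f * MonoidAlgebra.of ℂ (HeckeMonoid N) y ∈ colengthFiltration N n :=
          Submodule.span_mono (Set.image_mono fun z (hz : colength z < colength y) =>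
            (lt_of_lt_of_le hz (Nat.le_of_lt_succ hy) : colength z < n)) h1
        rw [← hf.eq, mul_assoc, ih _ h2]
      | zero => exact mul_zero f
      | add v w _ _ hv hw => rw [mul_add, hv, hw, add_zero]
      | smul r v _ hv => rw [mul_smul_comm, hv, smul_zero]
  have h1 := key (colength (1 : HeckeMonoid N) + 1) (MonoidAlgebra.of ℂ (HeckeMonoid N) 1)
    (Submodule.subset_span ⟨1, Nat.lt_succ_self _, rfl⟩)
  rwa [map_one, mul_one] at h1

/-- An idempotent on which only one character does not vanish, with value `1`, is primitive. -/
theorem isPrimitiveIdempotent_of_heckeChar {e : HeckeAlgebra N} (D : SignedDiagram N)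
    (he : IsIdempotentElem e) (h1 : heckeChar D e = 1) (h0 : ∀ E, E ≠ D → heckeChar E e = 0) :
    IsPrimitiveIdempotent e := by
  refine ⟨he, ?_, ?_⟩
  · rintro rfl
    simp at h1
  intro f g hf hg _ _ hfg
  have hval {f : HeckeAlgebra N} (hf : IsIdempotentElem f) (E : SignedDiagram N) :
      heckeChar E f = 0 ∨ heckeChar E f = 1 :=
    IsIdempotentElem.iff_eq_zero_or_one.1 (hf.map (heckeChar E))
  have hsum (E : SignedDiagram N) : heckeChar E e = heckeChar E f + heckeChar E g := by
    rw [hfg, map_add]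
  have hE (E : SignedDiagram N) (h : E ≠ D) : heckeChar E f = 0 ∧ heckeChar E g = 0 := by
    have := hsum E
    rw [h0 E h] at this
    rcases hval hf E with h2 | h2 <;> rcases hval hg E with h3 | h3 <;> rw [h2, h3] at this
    · exact ⟨h2, h3⟩
    all_goals norm_num at this
  have hD := hsum D
  rw [h1] at hD
  have hcases : heckeChar D f = 0 ∨ heckeChar D g = 0 := by
    rcases hval hf D with h2 | h2
    · exact Or.inl h2
    · rw [h2] at hD
      exact Or.inr (by simpa using hD)
  refine hcases.imp (fun h => ?_) (fun h => ?_)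
  · refine eq_zero_of_heckeChar_eq_zero hf fun E => ?_
    rcases eq_or_ne E D with rfl | h4
    exacts [h, (hE E h4).1]
  · refine eq_zero_of_heckeChar_eq_zero hg fun E => ?_
    rcases eq_or_ne E D with rfl | h4
    exacts [h, (hE E h4).2]

end Character

/-! ### The blocks of a signed diagram -/

section Blocks

variable {N : ℕ}

/-- The families `π_i` and `1 - π_i` in the `0`-Hecke algebra, where `π_i = 1` if `i` is not a
node. -/
noncomputable def signedGen (N : ℕ) (ε : Bool) (i : ℕ) : HeckeAlgebra N :=
  if ε then MonoidAlgebra.of ℂ (HeckeMonoid N) (natGen N i)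
  else 1 - MonoidAlgebra.of ℂ (HeckeMonoid N) (natGen N i)

theorem IsZeroHecke.map {M M' : Type*} [Monoid M] [Monoid M'] {p : ℕ → M} (hp : IsZeroHecke p)
    (f : M →* M') : IsZeroHecke fun i => f (p i) where
  idem i := by rw [← map_mul, hp.idem]
  comm i j h := by rw [← map_mul, hp.comm i j h, map_mul]
  braid i := by simp only [← map_mul, hp.braid]

theorem IsZeroHecke.one_sub {A : Type*} [Ring A] {p : ℕ → A} (hp : IsZeroHecke p) :
    IsZeroHecke fun i => 1 - p i where
  idem i := (IsIdempotentElem.one_sub (hp.idem i)).eq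
  comm i j h := by
    have h1 : Commute (p i) (p j) := hp.comm i j h
    have h2 : Commute (1 - p i) (p j) := (Commute.one_left _).sub_left h1
    exact ((Commute.one_right _).sub_right h2).eq
  braid i := one_sub_braid (hp.idem i) (hp.idem (i + 1)) (hp.braid i)

theorem isSignedZeroHecke_signedGen (N : ℕ) : IsSignedZeroHecke (signedGen N) where
  isZeroHecke ε := by
    have h := (isZeroHecke_natGen N).map (MonoidAlgebra.of ℂ (HeckeMonoid N))
    cases ε
    · exact h.one_sub
    · exact h
  add_not ε i := by
    cases ε <;> simp [signedGen]

theorem heckeChar_signedGen (D : SignedDiagram N) (i : Fin (N - 1)) :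
    heckeChar D (signedGen N (D i) i) = 1 := by
  unfold signedGen
  split_ifs with h <;> simp only [map_sub, map_one, heckeChar_of, natGen_val, monoidChar_gen, h] <;>
    simp

/-- `B` is a nonempty list of nodes at which `D` has the sign `ε`. -/
def IsRun (D : SignedDiagram N) (ε : Bool) (B : List (Fin (N - 1))) : Prop :=
  B ≠ [] ∧ ∀ i ∈ B, D i = ε

theorem add_length_le_of_range' {B : List (Fin (N - 1))} {a : ℕ} (hB : B ≠ [])
    (h : B.map Fin.val = List.range' a B.length) : a + B.length ≤ N - 1 := by
  have hpos := List.length_pos_iff.2 hB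
  have : a + B.length - 1 ∈ B.map Fin.val := by
    rw [h, List.mem_range'_1]
    omega
  obtain ⟨i, -, hi⟩ := List.mem_map.1 this
  have := i.2
  omega

theorem blockElement_eq_longestProd {D : SignedDiagram N} {ε : Bool} {B : List (Fin (N - 1))}
    {a : ℕ} (hB : IsRun D ε B) (h : B.map Fin.val = List.range' a B.length) :
    blockElement D B = longestProd (signedGen N ε) a B.length := by
  have hle := add_length_le_of_range' hB.1 h
  have hJ (i : Fin (N - 1)) : i ∈ {i | i ∈ B} ↔ a ≤ (i : ℕ) ∧ (i : ℕ) < a + B.length := by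
    rw [← List.mem_range'_1, ← h, List.mem_map]
    constructor
    · exact fun h => ⟨i, h, rfl⟩
    · rintro ⟨j, hj, hji⟩
      rwa [← Fin.val_injective hji]
  have hplus : wPlus {i | i ∈ B} = longestProd (signedGen N true) a B.length := by
    rw [wPlus, longest_eq_longestProd hle hJ, map_longestProd]
    rfl
  cases ε
  · have hne : ¬ ∀ i ∈ B, D i = true := by
      obtain ⟨i, hi⟩ := List.exists_mem_of_ne_nil B hB.1
      intro h1
      simpa [hB.2 i hi] using h1 i hi
    rw [blockElement, if_neg hne, wMinus, hplus, map_longestProd]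
    refine longestProd_congr fun i _ h2 => ?_
    have h3 : Psi N (algGen ⟨i, by omega⟩) = 1 - algGen ⟨i, by omega⟩ := Psi_algGen _
    simpa [signedGen, natGen_of_lt (show i < N - 1 by omega), algGen] using h3
  · rw [blockElement, if_pos hB.2, hplus]

theorem heckeChar_blockElement {D : SignedDiagram N} {ε : Bool} {B : List (Fin (N - 1))}
    {a : ℕ} (hB : IsRun D ε B) (h : B.map Fin.val = List.range' a B.length) :
    heckeChar D (blockElement D B) = 1 := by
  rw [blockElement_eq_longestProd hB h, map_longestProd]
  have hle := add_length_le_of_range' hB.1 h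
  have : longestProd (fun i => heckeChar D (signedGen N ε i)) a B.length =
      longestProd (fun _ => (1 : ℂ)) a B.length := by
    refine longestProd_congr fun i h1 h2 => ?_
    have hi : (⟨i, by omega⟩ : Fin (N - 1)) ∈ B := by
      have : i ∈ B.map Fin.val := by
        rw [h, List.mem_range'_1]
        omega
      obtain ⟨j, hj, rfl⟩ := List.mem_map.1 this
      exact hj
    rw [← hB.2 _ hi]
    exact heckeChar_signedGen D ⟨i, by omega⟩
  rw [this]
  simpa using longestProd_mul_of_absorb (p := fun _ => (1 : ℂ)) (a := a) (n := B.length) (x := 1)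
    fun _ _ _ => one_mul _

theorem range'_append_left {B : List (Fin (N - 1))} {l : List ℕ} {a n : ℕ}
    (h : B.map Fin.val ++ l = List.range' a n) :
    B.map Fin.val = List.range' a B.length ∧ l = List.range' (a + B.length) (n - B.length) := by
  have hlen := congrArg List.length h
  simp only [List.length_append, List.length_map, List.length_range'] at hlen
  have h1 : List.range' a n =
      List.range' a B.length ++ List.range' (a + B.length) (n - B.length) := by
    rw [List.range'_append_1]
    congr 1
    omega
  rw [h1] at h
  exact List.append_inj h (by simp)

/-- Consecutive runs of nodes, in the form used for sibling rivalry. -/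
theorem exists_sandwich_eq {D : SignedDiagram N} {m : List (List (Fin (N - 1)))} {a n : ℕ}
    (hm : ∀ B ∈ m, ∃ ε, IsRun D ε B) (h : m.flatten.map Fin.val = List.range' a n) :
    ∃ t, blocksEnd a t = a + n ∧ ∀ y, sandwich (signedGen N) y a t =
      (m.map (blockElement D)).prod * y * (m.reverse.map (blockElement D)).prod := by
  induction m generalizing a n with
  | nil =>
    have : 0 = n := by simpa using congrArg List.length h
    exact ⟨[], by simp [blocksEnd, ← this], fun y => by simp [sandwich]⟩
  | cons B m ih =>
    rw [List.flatten_cons, List.map_append] at h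
    obtain ⟨h1, h2⟩ := range'_append_left h
    obtain ⟨ε, hB⟩ := hm B (by simp)
    obtain ⟨t, h3, h4⟩ := ih (fun B hB => hm B (by simp [hB])) h2
    have hpos := List.length_pos_iff.2 hB.1
    have hlen := congrArg List.length h
    simp only [List.length_append, List.length_map, List.length_range'] at hlen
    refine ⟨(ε, B.length - 1) :: t, ?_, fun y => ?_⟩
    · rw [blocksEnd, show a + (B.length - 1) + 1 = a + B.length by omega, h3]
      omega
    · rw [sandwich, show a + (B.length - 1) + 1 = a + B.length by omega, Nat.sub_add_cancel hpos,
        h4, ← blockElement_eq_longestProd hB h1]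
      simp [mul_assoc]

theorem take_finRange_map_val {n k : ℕ} (h : k ≤ n) :
    ((List.finRange n).take k).map Fin.val = List.range' 0 k := by
  exact List.ext_getElem (by simpa using h) fun i _ _ => by simp

theorem mem_take_finRange {n k : ℕ} {i : Fin n} (h : k ≤ n) (hi : i ∈ (List.finRange n).take k) :
    (i : ℕ) < k := by
  have : (i : ℕ) ∈ ((List.finRange n).take k).map Fin.val := List.mem_map.2 ⟨i, hi, rfl⟩
  rw [take_finRange_map_val h, List.mem_range'_1] at this
  omega

theorem take_succ_finRange {n k : ℕ} (h : k < n) :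
    (List.finRange n).take (k + 1) = (List.finRange n).take k ++ [⟨k, h⟩] := by
  rw [List.take_succ_eq_append_getElem (by simpa using h)]
  simp

theorem isChain_sign_iff (D : SignedDiagram N) (B : List (Fin (N - 1))) :
    (B.IsChain fun i j => (D i == D j) = true) ↔ ∀ i ∈ B, ∀ j ∈ B, D i = D j := by
  simp only [beq_iff_eq]
  have : Trans (fun i j => D i = D j) (fun i j => D i = D j) (fun i j => D i = D j) :=
    ⟨fun h1 h2 => h1.trans h2⟩
  constructor
  · intro h i hi j hj
    rcases eq_or_ne i j with rfl | hij
    · rfl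
    · have : Std.Symm fun i j => D i = D j := ⟨fun _ _ h => h.symm⟩
      exact h.pairwise.forall hi hj hij
  · intro h
    rw [List.isChain_iff_pairwise, List.pairwise_iff_forall_sublist]
    intro i j hij
    exact h i (hij.subset (by simp)) j (hij.subset (by simp))

theorem isRun_of_mem_blocks {D : SignedDiagram N} {k : ℕ} {B : List (Fin (N - 1))}
    (h : B ∈ blocks D k) : ∃ ε, IsRun D ε B := by
  have hne : B ≠ [] := List.ne_nil_of_mem_splitBy h
  obtain ⟨i, hi⟩ := List.exists_mem_of_ne_nil B hne
  exact ⟨D i, hne, fun j hj =>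
    (isChain_sign_iff D B).1 (List.isChain_of_mem_splitBy h) j hj i hi⟩

theorem flatten_blocks (D : SignedDiagram N) (k : ℕ) :
    (blocks D k).flatten = (List.finRange (N - 1)).take k :=
  List.flatten_splitBy _ _

theorem mem_block_lt {D : SignedDiagram N} {k : ℕ} (hk : k ≤ N - 1) {B : List (Fin (N - 1))}
    (h : B ∈ blocks D k) {i : Fin (N - 1)} (hi : i ∈ B) : (i : ℕ) < k := by
  refine mem_take_finRange hk ?_
  rw [← flatten_blocks D]
  exact List.mem_flatten.2 ⟨B, h, hi⟩

/-- The blocks of `D_k` depend only on the signs of the first `k` nodes. -/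
theorem blocks_congr {D E : SignedDiagram N} {k : ℕ} (hk : k ≤ N - 1)
    (h : ∀ i : Fin (N - 1), (i : ℕ) < k → D i = E i) : blocks D k = blocks E k := by
  symm
  obtain ⟨h1, h2, h3, h4⟩ := List.splitBy_eq_iff.1 (rfl : blocks D k = blocks D k)
  refine List.splitBy_eq_iff.2 ⟨h1, h2, fun B hB => ?_, ?_⟩
  · refine (h3 B hB).imp_of_mem_imp fun i j hi hj hij => ?_
    rwa [← h i (mem_block_lt hk hB hi), ← h j (mem_block_lt hk hB hj)]
  · refine h4.imp_of_mem_imp fun B B' hB hB' ⟨ha, hb, hab⟩ => ⟨ha, hb, ?_⟩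
    rwa [← h _ (mem_block_lt hk hB (List.getLast_mem ha)),
      ← h _ (mem_block_lt hk hB' (List.head_mem hb))]

theorem blockElement_congr {D E : SignedDiagram N} {B : List (Fin (N - 1))}
    (h : ∀ i ∈ B, D i = E i) : blockElement D B = blockElement E B := by
  have : (∀ i ∈ B, D i = true) ↔ ∀ i ∈ B, E i = true :=
    forall₂_congr fun i hi => by rw [h i hi]
  simp only [blockElement, this]

theorem leftFactor_congr {D E : SignedDiagram N} {k : ℕ} (hk : k ≤ N - 1)
    (h : ∀ i : Fin (N - 1), (i : ℕ) < k → D i = E i) : leftFactor D k = leftFactor E k := by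
  rw [leftFactor, leftFactor, ← blocks_congr hk h]
  congr 1
  exact List.map_congr_left fun B hB => blockElement_congr fun i hi => h i (mem_block_lt hk hB hi)

theorem rightFactor_congr {D E : SignedDiagram N} {k : ℕ} (hk : k ≤ N - 1)
    (h : ∀ i : Fin (N - 1), (i : ℕ) < k → D i = E i) : rightFactor D k = rightFactor E k := by
  rw [rightFactor, rightFactor, ← blocks_congr hk h]
  congr 1
  exact List.map_congr_left fun B hB =>
    blockElement_congr fun i hi => h i (mem_block_lt hk (List.mem_reverse.1 hB) hi)

theorem blocks_zero (D : SignedDiagram N) : blocks D 0 = [] := by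
  simp [blocks]

theorem blocks_succ_of_ne {D : SignedDiagram N} {k : ℕ} (hk : k < N - 1)
    (h : ∀ i ∈ ((List.finRange (N - 1)).take k).getLast?, D i ≠ D ⟨k, hk⟩) :
    blocks D (k + 1) = blocks D k ++ [[⟨k, hk⟩]] := by
  rw [blocks, take_succ_finRange hk, List.splitBy_append_cons]
  · rfl
  · exact fun i hi => by simpa using h i hi

theorem blocks_succ_of_eq {D : SignedDiagram N} {k : ℕ} (hk : k < N - 1)
    {m : List (List (Fin (N - 1)))} {B : List (Fin (N - 1))} (h : blocks D k = m ++ [B])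
    (hB : ∀ i ∈ B, D i = D ⟨k, hk⟩) :
    blocks D (k + 1) = m ++ [B ++ [⟨k, hk⟩]] := by
  obtain ⟨h1, h2, h3, h4⟩ := List.splitBy_eq_iff.1 h
  refine List.splitBy_eq_iff.2 ⟨?_, ?_, ?_, ?_⟩
  · rw [take_succ_finRange hk, h1]
    simp
  · simp only [List.mem_append, not_or] at h2 ⊢
    exact ⟨h2.1, by simp⟩
  · intro C hC
    rw [List.mem_append, List.mem_singleton] at hC
    rcases hC with hC | rfl
    · exact h3 C (by simp [hC])
    · rw [isChain_sign_iff]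
      intro i hi j hj
      have key : ∀ i ∈ B ++ [⟨k, hk⟩], D i = D ⟨k, hk⟩ := by
        intro i hi
        rw [List.mem_append, List.mem_singleton] at hi
        rcases hi with hi | rfl
        exacts [hB i hi, rfl]
      rw [key i hi, key j hj]
  · have hne : B ≠ [] := fun h => h2 (by simp [h])
    rw [List.isChain_append] at h4 ⊢
    refine ⟨h4.1, by simp, fun C hC C' hC' => ?_⟩
    obtain rfl : B ++ [⟨k, hk⟩] = C' := by simpa using hC'
    obtain ⟨ha, hb, hab⟩ := h4.2.2 C hC B (by simp)
    refine ⟨ha, by simp, ?_⟩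
    rw [List.head_append_of_ne_nil hb]
    exact hab

/-- Both `C_{D_k}` and its successor are sandwiches between `L_{D_k}` and `R_{D_k}`: the diagram
`D_{k+1}` puts `π_k` or `1 - π_k` in the middle, according to the sign of the node `k`. When the new
node prolongs the last block `P` of `D_k`, this is the recursion `w_{P ∪ {k}} = w_P π_k w_P`. -/
theorem prefixDemipotent_succ {D : SignedDiagram N} {k : ℕ} (hk : k < N - 1) :
    prefixDemipotent D (k + 1) =
      leftFactor D k * signedGen N (D ⟨k, hk⟩) k * rightFactor D k := by
  have hidem := ((isSignedZeroHecke_signedGen N).isZeroHecke (D ⟨k, hk⟩)).idem k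
  by_cases h : ∀ i ∈ ((List.finRange (N - 1)).take k).getLast?, D i ≠ D ⟨k, hk⟩
  · have h1 : blockElement D [⟨k, hk⟩] = signedGen N (D ⟨k, hk⟩) k := by
      rw [blockElement_eq_longestProd (ε := D ⟨k, hk⟩) (a := k) ⟨by simp, by simp⟩ (by simp)]
      simp [longestProd]
    simp only [prefixDemipotent, leftFactor, rightFactor, blocks_succ_of_ne hk h, List.map_append,
      List.prod_append, List.reverse_append, List.map_cons, List.map_nil, List.prod_singleton,
      List.reverse_singleton, h1]
    rw [mul_assoc, ← mul_assoc (signedGen N _ k) (signedGen N _ k), hidem, ← mul_assoc]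
  · push Not at h
    obtain ⟨i, hi, hDi⟩ := h
    obtain hm | ⟨m, B, hm⟩ := List.eq_nil_or_concat (blocks D k)
    · rw [← flatten_blocks D, hm] at hi
      simp at hi
    rw [List.concat_eq_append] at hm
    obtain ⟨ε, hB⟩ := isRun_of_mem_blocks (D := D) (k := k) (B := B) (by rw [hm]; simp)
    have hflat := flatten_blocks D k
    rw [hm, List.flatten_append, List.flatten_singleton] at hflat
    have hiB : i ∈ B := by
      rw [← hflat, List.getLast?_append_of_ne_nil _ hB.1] at hi
      exact List.mem_of_mem_getLast? hi
    obtain rfl : ε = D ⟨k, hk⟩ := (hB.2 i hiB).symm.trans hDi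
    have hval := take_finRange_map_val hk.le
    rw [← hflat, List.map_append] at hval
    obtain ⟨-, hBval⟩ := range'_append_left hval
    have hlen := congrArg List.length hval
    simp only [List.length_append, List.length_map, List.length_range'] at hlen
    set b := 0 + m.flatten.length with hb
    obtain hn : k - m.flatten.length = B.length := by omega
    rw [hn] at hBval
    have hk' : b + B.length = k := by omega
    have h1 := blockElement_eq_longestProd hB hBval
    have h2 : blockElement D (B ++ [⟨k, hk⟩]) =
        blockElement D B * signedGen N (D ⟨k, hk⟩) k * blockElement D B := by
      rw [blockElement_eq_longestProd (ε := D ⟨k, hk⟩) (a := b) ⟨by simp, ?_⟩, h1,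
        List.length_append, List.length_singleton, longestProd, hk']
      · rw [List.map_append, hBval, List.length_append, List.length_singleton, List.range'_1_concat,
          hk']
        rfl
      · intro j hj
        rw [List.mem_append, List.mem_singleton] at hj
        rcases hj with hj | rfl
        exacts [hB.2 j hj, rfl]
    have hw : blockElement D (B ++ [⟨k, hk⟩]) * blockElement D (B ++ [⟨k, hk⟩]) =
        blockElement D (B ++ [⟨k, hk⟩]) := by
      rw [h2, h1]
      have := longestProd_idem ((isSignedZeroHecke_signedGen N).isZeroHecke (D ⟨k, hk⟩)) b
        (B.length + 1)
      rwa [longestProd, hk'] at this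
    simp only [prefixDemipotent, leftFactor, rightFactor, blocks_succ_of_eq hk hm hB.2, hm,
      List.map_append, List.prod_append, List.reverse_append, List.map_cons, List.map_nil,
      List.prod_singleton, List.reverse_singleton]
    rw [mul_assoc, ← mul_assoc (blockElement D (B ++ _)) (blockElement D (B ++ _)), hw, h2]
    simp only [mul_assoc]

theorem exists_sandwich_eq_factors (D : SignedDiagram N) {k : ℕ} (hk : k ≤ N - 1) :
    ∃ t, blocksEnd 0 t = k ∧ ∀ y, sandwich (signedGen N) y 0 t =
      leftFactor D k * y * rightFactor D k := by
  obtain ⟨t, h1, h2⟩ := exists_sandwich_eq (D := D) (m := blocks D k) (a := 0) (n := k)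
    (fun B => isRun_of_mem_blocks) (by rw [flatten_blocks, take_finRange_map_val hk])
  exact ⟨t, by rw [h1, zero_add], h2⟩

/-- Sibling rivalry: the two diagrams that extend `D_k` by one node annihilate each other. -/
theorem sibling_rivalry (D : SignedDiagram N) {k : ℕ} (hk : k ≤ N - 1) (ε : Bool) :
    leftFactor D k * signedGen N ε k * rightFactor D k *
      (leftFactor D k * signedGen N (!ε) k * rightFactor D k) = 0 := by
  obtain ⟨t, h1, h2⟩ := exists_sandwich_eq_factors D hk
  have := (sandwich_mul_sandwich_aux (isSignedZeroHecke_signedGen N) ε t 0 k h1.symm).1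
  rwa [h2, h2] at this

theorem prefixDemipotent_zero (D : SignedDiagram N) : prefixDemipotent D 0 = 1 := by
  simp [prefixDemipotent, leftFactor, rightFactor, blocks_zero]

theorem heckeChar_prefixDemipotent (D : SignedDiagram N) {k : ℕ} (hk : k ≤ N - 1) :
    heckeChar D (prefixDemipotent D k) = 1 := by
  have key : ∀ (m : List (List (Fin (N - 1)))) (a n : ℕ), (∀ B ∈ m, ∃ ε, IsRun D ε B) →
      m.flatten.map Fin.val = List.range' a n →
      ∀ B ∈ m, heckeChar D (blockElement D B) = 1 := by
    intro m
    induction m with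
    | nil => simp
    | cons C m ih =>
      intro a n hm h B hB
      rw [List.flatten_cons, List.map_append] at h
      obtain ⟨h1, h2⟩ := range'_append_left h
      rcases List.mem_cons.1 hB with rfl | hB
      · obtain ⟨ε, hB⟩ := hm B (by simp)
        exact heckeChar_blockElement hB h1
      · exact ih _ _ (fun B hB => hm B (by simp [hB])) h2 B hB
  have key := key (blocks D k) 0 k (fun B => isRun_of_mem_blocks)
    (by rw [flatten_blocks, take_finRange_map_val hk])
  rw [prefixDemipotent, map_mul, leftFactor, rightFactor, map_list_prod, map_list_prod,
    List.prod_eq_one, List.prod_eq_one, one_mul]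
  · simpa using key
  · simpa using key

end Blocks

/-! ### From sibling rivalry to orthogonal idempotents -/

section Chain

variable {A : Type*} [Ring A] {c : ℕ → A} {n : ℕ}

/-- If a sequence with `c 0 = 1` satisfies `c k c (k + 1) = c (k + 1) ^ 2`, then
`c 1 c 2 ⋯ c k` is every power of `c k` with an exponent of at least `k`. -/
theorem prod_eq_pow (h0 : c 0 = 1) (h : ∀ k < n, c k * c (k + 1) = c (k + 1) * c (k + 1)) {k : ℕ}
    (hk : k ≤ n) {m : ℕ} (hm : k ≤ m) :
    ((List.range k).map fun i => c (i + 1)).prod = c k ^ m := by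
  induction k generalizing m with
  | zero => simp [h0]
  | succ k ih =>
    have hpow : ∀ m, c (k + 1) ^ (m + 1) = c k ^ m * c (k + 1) := by
      intro m
      induction m with
      | zero => simp
      | succ m ih' => rw [pow_succ, ih', mul_assoc, ← h k hk, ← mul_assoc, ← pow_succ]
    obtain ⟨m, rfl⟩ : ∃ l, m = l + 1 := ⟨m - 1, by omega⟩
    rw [List.range_succ, List.map_append, List.prod_append, ih (by omega) (by omega : k ≤ m), hpow]
    simp

theorem prod_mul_prod (h0 : c 0 = 1) (h : ∀ k < n, c k * c (k + 1) = c (k + 1) * c (k + 1))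
    (h' : ∀ k < n, c (k + 1) * c k = c (k + 1) * c (k + 1)) {j k : ℕ} (hk : k ≤ n) (hj : j ≤ k) :
    ((List.range j).map fun i => c (i + 1)).prod * ((List.range k).map fun i => c (i + 1)).prod =
        ((List.range k).map fun i => c (i + 1)).prod ∧
      ((List.range k).map fun i => c (i + 1)).prod * ((List.range j).map fun i => c (i + 1)).prod =
        ((List.range k).map fun i => c (i + 1)).prod := by
  have hid : ∀ k ≤ n, ((List.range k).map fun i => c (i + 1)).prod *
      ((List.range k).map fun i => c (i + 1)).prod =
        ((List.range k).map fun i => c (i + 1)).prod := by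
    intro k hk
    rw [prod_eq_pow h0 h hk le_rfl, ← pow_add, ← prod_eq_pow h0 h hk le_rfl,
      ← prod_eq_pow h0 h hk (by omega : k ≤ k + k)]
  induction k, hj using Nat.le_induction with
  | base => exact ⟨hid j hk, hid j hk⟩
  | succ k hj ih =>
    obtain ⟨ih1, ih2⟩ := ih (by omega)
    have hcomm : Commute (c (k + 1)) ((List.range k).map fun i => c (i + 1)).prod := by
      rw [prod_eq_pow h0 h (by omega) le_rfl]
      exact Commute.pow_right ((h' k hk).trans (h k hk).symm) k
    rw [List.range_succ, List.map_append, List.prod_append, List.map_singleton, List.prod_singleton]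
    exact ⟨by rw [← mul_assoc, ih1], by rw [← hcomm.eq, mul_assoc, ih2]⟩

end Chain

section Main

variable {N : ℕ}

/-- The sibling of `D_{k+1}`. -/
def flipSign (D : SignedDiagram N) (k : ℕ) : SignedDiagram N :=
  fun i => if (i : ℕ) = k then !D i else D i

theorem flipSign_of_lt (D : SignedDiagram N) {k : ℕ} (i : Fin (N - 1)) (h : (i : ℕ) < k) :
    flipSign D k i = D i :=
  if_neg h.ne

theorem flipSign_flipSign (D : SignedDiagram N) (k : ℕ) : flipSign (flipSign D k) k = D := by
  funext i
  unfold flipSign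
  split_ifs <;> simp

theorem prefixDemipotent_congr {D E : SignedDiagram N} {k : ℕ} (hk : k ≤ N - 1)
    (h : ∀ i : Fin (N - 1), (i : ℕ) < k → D i = E i) :
    prefixDemipotent D k = prefixDemipotent E k := by
  rw [prefixDemipotent, prefixDemipotent, leftFactor_congr hk h, rightFactor_congr hk h]

theorem prefixDemipotent_succ_of_ne {D E : SignedDiagram N} {k : ℕ} (hk : k < N - 1)
    (h : ∀ i : Fin (N - 1), (i : ℕ) < k → D i = E i) (hne : D ⟨k, hk⟩ ≠ E ⟨k, hk⟩) :
    prefixDemipotent E (k + 1) =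
      leftFactor D k * signedGen N (!D ⟨k, hk⟩) k * rightFactor D k := by
  rw [prefixDemipotent_succ hk, leftFactor_congr hk.le h, rightFactor_congr hk.le h,
    Bool.eq_not_of_ne hne.symm]

theorem sibling_mul_eq_zero {D E : SignedDiagram N} {k : ℕ} (hk : k < N - 1)
    (h : ∀ i : Fin (N - 1), (i : ℕ) < k → D i = E i) (hne : D ⟨k, hk⟩ ≠ E ⟨k, hk⟩) :
    prefixDemipotent D (k + 1) * prefixDemipotent E (k + 1) = 0 := by
  rw [prefixDemipotent_succ hk, prefixDemipotent_succ_of_ne hk h hne]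
  exact sibling_rivalry D hk.le _

theorem sibling_add {D E : SignedDiagram N} {k : ℕ} (hk : k < N - 1)
    (h : ∀ i : Fin (N - 1), (i : ℕ) < k → D i = E i) (hne : D ⟨k, hk⟩ ≠ E ⟨k, hk⟩) :
    prefixDemipotent D (k + 1) + prefixDemipotent E (k + 1) = prefixDemipotent D k := by
  rw [prefixDemipotent_succ hk, prefixDemipotent_succ_of_ne hk h hne, ← add_mul, ← mul_add,
    (isSignedZeroHecke_signedGen N).add_not, mul_one, prefixDemipotent]

theorem flipSign_ne (D : SignedDiagram N) {k : ℕ} (hk : k < N - 1) :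
    D ⟨k, hk⟩ ≠ flipSign D k ⟨k, hk⟩ := by
  simp [flipSign]

theorem sibling_add_flipSign (D : SignedDiagram N) {k : ℕ} (hk : k < N - 1) :
    prefixDemipotent D (k + 1) + prefixDemipotent (flipSign D k) (k + 1) =
      prefixDemipotent D k :=
  sibling_add hk (fun i hi => (flipSign_of_lt D i hi).symm) (flipSign_ne D hk)

theorem prefixDemipotent_mul_succ (D : SignedDiagram N) {k : ℕ} (hk : k < N - 1) :
    prefixDemipotent D k * prefixDemipotent D (k + 1) =
      prefixDemipotent D (k + 1) * prefixDemipotent D (k + 1) := by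
  rw [← sibling_add_flipSign D hk, add_mul,
    sibling_mul_eq_zero hk (fun i hi => flipSign_of_lt D i hi) (flipSign_ne D hk).symm, add_zero]

theorem succ_mul_prefixDemipotent (D : SignedDiagram N) {k : ℕ} (hk : k < N - 1) :
    prefixDemipotent D (k + 1) * prefixDemipotent D k =
      prefixDemipotent D (k + 1) * prefixDemipotent D (k + 1) := by
  rw [← sibling_add_flipSign D hk, mul_add,
    sibling_mul_eq_zero hk (fun i hi => (flipSign_of_lt D i hi).symm) (flipSign_ne D hk), add_zero]

/-- The product `C_{D_1} ⋯ C_{D_k}`. -/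
noncomputable def prefixIdempotent (D : SignedDiagram N) (k : ℕ) : HeckeAlgebra N :=
  ((List.range k).map fun i => prefixDemipotent D (i + 1)).prod

theorem prefixIdempotent_succ (D : SignedDiagram N) (k : ℕ) :
    prefixIdempotent D (k + 1) = prefixIdempotent D k * prefixDemipotent D (k + 1) := by
  simp [prefixIdempotent, List.range_succ]

theorem prefixIdempotent_eq_pow (D : SignedDiagram N) {k m : ℕ} (hk : k ≤ N - 1) (hm : k ≤ m) :
    prefixIdempotent D k = prefixDemipotent D k ^ m :=
  prod_eq_pow (prefixDemipotent_zero D) (fun _ h => prefixDemipotent_mul_succ D h) hk hm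

theorem prefixIdempotent_mul (D : SignedDiagram N) {j k : ℕ} (hk : k ≤ N - 1) (hj : j ≤ k) :
    prefixIdempotent D j * prefixIdempotent D k = prefixIdempotent D k ∧
      prefixIdempotent D k * prefixIdempotent D j = prefixIdempotent D k :=
  prod_mul_prod (prefixDemipotent_zero D) (fun _ h => prefixDemipotent_mul_succ D h)
    (fun _ h => succ_mul_prefixDemipotent D h) hk hj

theorem diagramIdempotent_eq (D : SignedDiagram N) :
    diagramIdempotent D = prefixIdempotent D (N - 1) :=
  rfl

theorem isIdempotentElem_diagramIdempotent (D : SignedDiagram N) :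
    IsIdempotentElem (diagramIdempotent D) :=
  (prefixIdempotent_mul D le_rfl le_rfl).1

theorem diagramIdempotent_eq_pow (D : SignedDiagram N) {m : ℕ} (hm : N - 1 ≤ m) :
    diagramIdempotent D = diagramDemipotent D ^ m :=
  prefixIdempotent_eq_pow D le_rfl hm

/-- Distinct diagrams have distinct siblings among their prefixes, at the first node where they
differ. -/
theorem diagramIdempotent_mul_eq_zero {D E : SignedDiagram N} (hne : D ≠ E) :
    diagramIdempotent D * diagramIdempotent E = 0 := by
  classical
  have hex : ∃ k, ∃ hk : k < N - 1, D ⟨k, hk⟩ ≠ E ⟨k, hk⟩ := by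
    obtain ⟨i, hi⟩ := Function.ne_iff.1 hne
    exact ⟨i, i.2, hi⟩
  obtain ⟨hk, hDE⟩ := Nat.find_spec hex
  set k := Nat.find hex
  have hlt (i : Fin (N - 1)) (hi : (i : ℕ) < k) : D i = E i := by
    by_contra h
    exact Nat.find_min hex hi ⟨i.2, h⟩
  have h0 : prefixIdempotent D (k + 1) * prefixIdempotent E (k + 1) = 0 := by
    rw [prefixIdempotent_eq_pow D hk le_rfl, prefixIdempotent_eq_pow E hk le_rfl, pow_succ,
      pow_succ', mul_assoc, ← mul_assoc (prefixDemipotent D (k + 1)),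
      sibling_mul_eq_zero hk hlt hDE, zero_mul, mul_zero]
  rw [diagramIdempotent_eq, diagramIdempotent_eq,
    ← (prefixIdempotent_mul D le_rfl (Nat.succ_le_of_lt hk)).2,
    ← (prefixIdempotent_mul E le_rfl (Nat.succ_le_of_lt hk)).1, mul_assoc,
    ← mul_assoc (prefixIdempotent D (k + 1)), h0, zero_mul, mul_zero]

theorem prefixIdempotent_add_flipSign (D : SignedDiagram N) {k : ℕ} (hk : k < N - 1) :
    prefixIdempotent D (k + 1) + prefixIdempotent (flipSign D k) (k + 1) =
      prefixIdempotent D k := by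
  have h : prefixIdempotent (flipSign D k) k = prefixIdempotent D k := by
    rw [prefixIdempotent_eq_pow _ hk.le le_rfl, prefixIdempotent_eq_pow _ hk.le le_rfl,
      prefixDemipotent_congr hk.le (flipSign_of_lt D)]
  rw [prefixIdempotent_succ, prefixIdempotent_succ, h, ← mul_add, sibling_add_flipSign D hk,
    prefixIdempotent_eq_pow D hk.le le_rfl, ← pow_succ, ← prefixIdempotent_eq_pow D hk.le le_rfl,
    ← prefixIdempotent_eq_pow D hk.le (Nat.le_succ k)]

/-- Pairing the diagrams that differ in the node `k` only shows that, over all diagrams on `N - 1`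
nodes, the sum of the idempotents of the prefixes is halved with each further node. -/
theorem two_pow_smul_sum_prefixIdempotent {k : ℕ} (hk : k ≤ N - 1) :
    (2 ^ k : ℂ) • ∑ D : SignedDiagram N, prefixIdempotent D k = (2 ^ (N - 1) : ℂ) • 1 := by
  induction k with
  | zero =>
    have h1 (D : SignedDiagram N) : prefixIdempotent D 0 = 1 := rfl
    simp only [h1, Finset.sum_const, pow_zero, one_smul]
    rw [← Nat.cast_smul_eq_nsmul ℂ]
    simp
  | succ k ih =>
    have h1 : ∑ D : SignedDiagram N, prefixIdempotent (flipSign D k) (k + 1) =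
        ∑ D : SignedDiagram N, prefixIdempotent D (k + 1) :=
      Equiv.sum_comp ⟨fun D => flipSign D k, fun D => flipSign D k,
        fun D => flipSign_flipSign D k, fun D => flipSign_flipSign D k⟩
        fun D => prefixIdempotent D (k + 1)
    have h2 : (2 : ℂ) • ∑ D : SignedDiagram N, prefixIdempotent D (k + 1) =
        ∑ D : SignedDiagram N, prefixIdempotent D k := by
      rw [two_smul]
      nth_rewrite 2 [← h1]
      rw [← Finset.sum_add_distrib]
      exact Finset.sum_congr rfl fun D _ => prefixIdempotent_add_flipSign D hk
    rw [pow_succ, mul_smul, h2, ih (by omega)]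

theorem sum_diagramIdempotent : ∑ D : SignedDiagram N, diagramIdempotent D = 1 := by
  have h := two_pow_smul_sum_prefixIdempotent (N := N) le_rfl
  exact smul_right_injective _ (pow_ne_zero (N - 1) (two_ne_zero' ℂ)) h

theorem heckeChar_diagramIdempotent (D : SignedDiagram N) :
    heckeChar D (diagramIdempotent D) = 1 := by
  rw [diagramIdempotent_eq_pow D le_rfl, map_pow, diagramDemipotent,
    heckeChar_prefixDemipotent D le_rfl, one_pow]

theorem heckeChar_diagramIdempotent_of_ne {D E : SignedDiagram N} (h : E ≠ D) :
    heckeChar E (diagramIdempotent D) = 0 := by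
  have := congrArg (heckeChar E) (diagramIdempotent_mul_eq_zero h)
  rwa [map_mul, heckeChar_diagramIdempotent, one_mul, map_zero] at this

theorem isPrimitiveIdempotent_diagramIdempotent (D : SignedDiagram N) :
    IsPrimitiveIdempotent (diagramIdempotent D) :=
  isPrimitiveIdempotent_of_heckeChar D (isIdempotentElem_diagramIdempotent D)
    (heckeChar_diagramIdempotent D) fun _ h => heckeChar_diagramIdempotent_of_ne h

theorem diagramIdempotent_injective :
    Function.Injective fun D : SignedDiagram N => diagramIdempotent D := by
  intro D E h
  by_contra hne
  have h1 := heckeChar_diagramIdempotent_of_ne (Ne.symm hne)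
  rw [show diagramIdempotent D = diagramIdempotent E from h, heckeChar_diagramIdempotent] at h1
  exact one_ne_zero h1

end Main

end ZeroHecke

theorem theorem3p6 (N : ℕ) (hN : 1 ≤ N) :
    (∀ D : ZeroHecke.SignedDiagram N,
      ZeroHecke.IsDemipotent (ZeroHecke.diagramDemipotent D) ∧
      ZeroHecke.diagramIdempotent D = ZeroHecke.diagramDemipotent D ^ N ∧
      (∀ k : ℕ, ZeroHecke.diagramDemipotent D ^ k = ZeroHecke.diagramDemipotent D ^ (k + 1) →
        ZeroHecke.diagramIdempotent D = ZeroHecke.diagramDemipotent D ^ k) ∧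
      ZeroHecke.IsPrimitiveIdempotent (ZeroHecke.diagramIdempotent D)) ∧
    (∀ D E : ZeroHecke.SignedDiagram N, D ≠ E →
      ZeroHecke.diagramIdempotent D * ZeroHecke.diagramIdempotent E = 0) ∧
    ∑ D : ZeroHecke.SignedDiagram N, ZeroHecke.diagramIdempotent D = 1 ∧
    (Set.range (fun D : ZeroHecke.SignedDiagram N => ZeroHecke.diagramIdempotent D)).ncard
      = 2 ^ (N - 1) := by
  refine ⟨fun D => ⟨⟨N, ?_⟩, ?_, fun k hk => ?_,
    ZeroHecke.isPrimitiveIdempotent_diagramIdempotent D⟩,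
    fun D E h => ZeroHecke.diagramIdempotent_mul_eq_zero h, ZeroHecke.sum_diagramIdempotent, ?_⟩
  · rw [← ZeroHecke.diagramIdempotent_eq_pow D (by omega : N - 1 ≤ N),
      ← ZeroHecke.diagramIdempotent_eq_pow D (by omega : N - 1 ≤ N + 1)]
  · exact ZeroHecke.diagramIdempotent_eq_pow D (by omega)
  · have hstable : ∀ l, ZeroHecke.diagramDemipotent D ^ (k + l) =
        ZeroHecke.diagramDemipotent D ^ k := by
      intro l
      induction l with
      | zero => rfl
      | succ l ih => rw [← add_assoc, pow_succ, ih, ← pow_succ, ← hk]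
    rw [ZeroHecke.diagramIdempotent_eq_pow D (by omega : N - 1 ≤ k + N), hstable]
  · rw [← Set.image_univ, Set.ncard_image_of_injective _ ZeroHecke.diagramIdempotent_injective,
      Set.ncard_univ, Nat.card_eq_fintype_card]
    simp
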